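/- **Proposition.** Let $n \ge p \ge 1$ be integers, let $x_1,\dots,x_n$ be i.i.d. $\mathcal N_p(0,I_p)$ vectors and $S=\sum_{j=1}^n x_jx_j^\top$, so that $S$ has the Wishart distribution $\mathcal W(n,I_p)$. Let $V$ be a random matrix with the normalized Wishart distribution $\mathcal{NW}(n,p)$, i.e. with the law of $S/\operatorname{tr}(S)$. Let $\operatorname{vec}$ denote column-wise vectorization, and let $K_{p,p}$ be the $p^2\times p^2$ commutation matrix, i.e. $K_{p,p}\operatorname{vec}(A)=\operatorname{vec}(A^\top)$ for all $A\in\mathbb R^{p\times p}$. Then: 1. $E[V]=\frac1p I_p$; 2. $E[\operatorname{vec}(V)\operatorname{vec}(V)^\top]=\frac{1}{np(np+2)}\left(n(I_{p^2}+K_{p,p})+n^2\operatorname{vec}(I_p)\operatorname{vec}(I_p)^\top\right)$; 3. $V$ is invertible with probability $1$; 4. if $n>p+1$, then the entries of $V^{-1}$ are integrable and $E[V^{-1}]=\frac{np-2}{n-p-1}I_p$; 5. if $n>p+3$, then the entries of $\operatorname{vec}(V^{-1})\operatorname{vec}(V^{-1})^\top$ are integrable and $$E[\operatorname{vec}(V^{-1})\operatorname{vec}(V^{-1})^\top]=\frac{(np-2)(np-4)}{(n-p)(n-p-1)(n-p-3)}\left[(I_{p^2}+K_{p,p})+(n-p-2)\operatorname{vec}(I_p)\operatorname{vec}(I_p)^\top\right].$$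 -/

import Mathlib

open MeasureTheory ProbabilityTheory Matrix

noncomputable section

/-- The Borel (product) sigma-algebra on real matrices. -/
instance instMeasurableSpaceRealMatrix {ι κ : Type*} : MeasurableSpace (Matrix ι κ ℝ) :=
  MeasurableSpace.pi

/-- The Wishart distribution with `n` degrees of freedom and center matrix `Sig`: the law of
`∑ j, x j * (x j)ᵀ` for `x 0, …, x (n - 1)` i.i.d. centered Gaussian vectors in `ℝ^p` with
covariance matrix `Sig`. -/
def wishart {p : ℕ} (n : ℕ) (Sig : Matrix (Fin p) (Fin p) ℝ) : Measure (Matrix (Fin p) (Fin p) ℝ) :=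
  (Measure.pi fun _ : Fin n => multivariateGaussian (0 : EuclideanSpace ℝ (Fin p)) Sig).map
    fun x => ∑ j, vecMulVec (x j).ofLp (x j).ofLp

/-- The normalized Wishart distribution: the law of `S / tr S` for `S` Wishart distributed with
`n` degrees of freedom and identity center matrix. -/
def normalizedWishart (n p : ℕ) : Measure (Matrix (Fin p) (Fin p) ℝ) :=
  (wishart n (1 : Matrix (Fin p) (Fin p) ℝ)).map fun S => (S.trace)⁻¹ • S

/-- The commutation matrix on `p × p` matrices; see `commutationMatrix_mulVec_vec`. -/
def commutationMatrix (p : ℕ) : Matrix (Fin p × Fin p) (Fin p × Fin p) ℝ :=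
  Matrix.of fun a b => if b = a.swap then 1 else 0

theorem commutationMatrix_mulVec_vec {p : ℕ} (A : Matrix (Fin p) (Fin p) ℝ) :
    commutationMatrix p *ᵥ vec A = vec Aᵀ := by
  funext a
  simp [commutationMatrix, mulVec, dotProduct, vec]

/-- The entries of the random matrix `X` are integrable and `E[X] = M`. -/
def HasExpectation {Ω ι κ : Type*} [MeasurableSpace Ω] (X : Ω → Matrix ι κ ℝ) (M : Matrix ι κ ℝ)
    (P : Measure Ω) : Prop :=
  ∀ i j, Integrable (fun ω => X ω i j) P ∧ ∫ ω, X ω i j ∂P = M i j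

theorem measurable_sum_vecMulVec (n p : ℕ) :
    Measurable fun x : Fin n → EuclideanSpace ℝ (Fin p) =>
      ∑ j, vecMulVec (x j).ofLp (x j).ofLp := by
  refine measurable_pi_iff.2 fun a => measurable_pi_iff.2 fun b => ?_
  simp only [Matrix.sum_apply, vecMulVec_apply]
  fun_prop

theorem measurable_trace_inv_smul (p : ℕ) :
    Measurable fun S : Matrix (Fin p) (Fin p) ℝ => (S.trace)⁻¹ • S := by
  refine measurable_pi_iff.2 fun a => measurable_pi_iff.2 fun b => ?_
  have h : ∀ i j, Measurable fun S : Matrix (Fin p) (Fin p) ℝ => S i j := fun i j =>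
    (measurable_pi_apply j).comp (measurable_pi_apply i)
  simp only [Matrix.smul_apply, smul_eq_mul, Matrix.trace, Matrix.diag]
  exact (Finset.measurable_sum _ fun i _ => h i i).inv.mul (h a b)

instance isProbabilityMeasure_wishart {p : ℕ} (n : ℕ) (Sig : Matrix (Fin p) (Fin p) ℝ) :
    IsProbabilityMeasure (wishart n Sig) :=
  Measure.isProbabilityMeasure_map (measurable_sum_vecMulVec n p).aemeasurable

instance isProbabilityMeasure_normalizedWishart (n p : ℕ) :
    IsProbabilityMeasure (normalizedWishart n p) :=
  Measure.isProbabilityMeasure_map (measurable_trace_inv_smul p).aemeasurable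

end

/-! Read by rows instead of columns, the data matrix turns `S` into the Gram matrix `G` of `p`
independent standard Gaussian vectors in `ℝ^n` (`wishart_one_eq`), and `tr G` into the squared norm
of a standard Gaussian vector of dimension `np`.

The normalization is handled by Euler's identity `E[‖x‖² f] = (N + d) E[f]` for `f` homogeneous of
degree `d`, with `N = np`. Applied once or twice, starting from the entries or products of entries
of `V` (degree 0) or of `G⁻¹` (degrees -2 and -4), it yields the factors `np`, `np(np+2)`, `np-2`
and `(np-2)(np-4)`. Only moments of `G` and `G⁻¹` remain.

Both laws are invariant under orthogonal conjugation. Hence first moments are scalar, and second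
moments are fixed by `A = E[S_ii²]` and `C = E[S_ij²]`, because `E[S_ii S_jj] + 2C = A`
(`IsOrthogonallyInvariant.integral_mul`). For `G` the diagonal entries are independent squared
norms. For `T = G⁻¹`, `T_ii` is the inverse squared distance from `x_i` to the span of the other
vectors, and the Schur complement `T_jj - T_ij²/T_ii` is that from `x_j` to the span of the vectors
other than `x_i, x_j`. Conditionally on the other vectors these are inverse squared norms of
Gaussian vectors in dimensions `n-p+1` and `n-p+2`, which gives `A` and the mean of the 2×2 minor
`T_ii T_jj - T_ij²`, hence `C`. -/

open MeasureTheory ProbabilityTheory Matrix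

noncomputable section

/-! ### Standard Gaussian measure: density, Euler's identity, moments of the norm. -/

section StdGaussian

variable {E : Type*} [NormedAddCommGroup E] [InnerProductSpace ℝ E]

/-- The density of the standard Gaussian measure with respect to the volume. -/
def gaussianDensity (x : E) : ℝ :=
  ((2 * Real.pi) ^ (Module.finrank ℝ E / 2 : ℝ))⁻¹ * Real.exp (-‖x‖ ^ 2 / 2)

theorem gaussianDensity_pos (x : E) : 0 < gaussianDensity x := by
  unfold gaussianDensity
  have := Real.pi_pos
  positivity

variable [MeasurableSpace E] [BorelSpace E]

@[fun_prop]
theorem measurable_gaussianDensity : Measurable (gaussianDensity : E → ℝ) := by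
  unfold gaussianDensity
  fun_prop

variable [FiniteDimensional ℝ E]

theorem integrable_exp_neg_mul_sq_norm {b : ℝ} (hb : 0 < b) :
    Integrable fun x : E => Real.exp (-b * ‖x‖ ^ 2) := by
  have h := (GaussianFourier.integrable_cexp_neg_mul_sq_norm_add
    (b := (b : ℂ)) (by simpa using hb) 0 (0 : E)).norm
  refine h.congr (Filter.Eventually.of_forall fun x => ?_)
  simp only [zero_mul, add_zero, Complex.norm_exp]
  congr 1
  norm_cast

theorem integrable_gaussianDensity : Integrable (gaussianDensity : E → ℝ) := by
  unfold gaussianDensity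
  refine Integrable.const_mul ?_ _
  refine (integrable_exp_neg_mul_sq_norm (E := E) (b := 1 / 2) (by norm_num)).congr
    (Filter.Eventually.of_forall fun x => ?_)
  dsimp only
  congr 1
  ring

/-- Both sides are finite measures, so it suffices to compare characteristic functions, and that of
the density is a known Gaussian Fourier integral. -/
theorem stdGaussian_eq_withDensity :
    stdGaussian E = (volume : Measure E).withDensity fun x => ENNReal.ofReal (gaussianDensity x) := by
  have : IsFiniteMeasure
      ((volume : Measure E).withDensity fun x => ENNReal.ofReal (gaussianDensity x)) :=
    isFiniteMeasure_withDensity_ofReal integrable_gaussianDensity.2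
  apply Measure.ext_of_charFun
  ext t
  rw [charFun_stdGaussian, charFun_apply, integral_withDensity_eq_integral_toReal_smul
    (by fun_prop) (by simp)]
  have key := GaussianFourier.integral_cexp_neg_mul_sq_norm_add
    (b := (1 / 2 : ℂ)) (by norm_num) Complex.I t
  have hpi : (0 : ℝ) < (2 * Real.pi) ^ (Module.finrank ℝ E / 2 : ℝ) := by
    have := Real.pi_pos
    positivity
  have h1 : ∀ x : E, (ENNReal.ofReal (gaussianDensity x)).toReal •
      Complex.exp (inner ℝ x t * Complex.I) =
      ((((2 * Real.pi) ^ (Module.finrank ℝ E / 2 : ℝ))⁻¹ : ℝ) : ℂ) *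
      Complex.exp (-(1 / 2 : ℂ) * ‖x‖ ^ 2 + Complex.I * inner ℝ t x) := by
    intro x
    rw [ENNReal.toReal_ofReal (gaussianDensity_pos x).le, gaussianDensity, Complex.real_smul,
      Complex.exp_add, real_inner_comm]
    push_cast
    rw [mul_assoc]
    congr 3
    · ring
    · ring
  simp_rw [h1]
  rw [integral_const_mul, key]
  have h2 : ((Real.pi : ℂ) / (1 / 2)) ^ (Module.finrank ℝ E / 2 : ℂ) =
      (((2 * Real.pi) ^ (Module.finrank ℝ E / 2 : ℝ) : ℝ) : ℂ) := by
    rw [Complex.ofReal_cpow (by have := Real.pi_pos; positivity)]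
    push_cast
    congr 1
    ring
  rw [h2, ← mul_assoc, ← Complex.ofReal_mul, inv_mul_cancel₀ hpi.ne']
  simp only [Complex.ofReal_one, one_mul, Complex.I_sq]
  congr 1
  ring

theorem integrable_stdGaussian_iff {f : E → ℝ} :
    Integrable f (stdGaussian E) ↔ Integrable fun x => f x * Real.exp (-‖x‖ ^ 2 / 2) := by
  rw [stdGaussian_eq_withDensity, integrable_withDensity_iff (by fun_prop) (by simp)]
  simp_rw [fun x : E => ENNReal.toReal_ofReal (gaussianDensity_pos x).le, gaussianDensity]
  have hpi : ((2 * Real.pi) ^ (Module.finrank ℝ E / 2 : ℝ))⁻¹ ≠ 0 := by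
    have := Real.pi_pos
    positivity
  simp_rw [mul_left_comm (f _)]
  exact integrable_const_mul_iff (isUnit_iff_ne_zero.2 hpi) _

theorem integral_stdGaussian_eq (f : E → ℝ) :
    ∫ x, f x ∂stdGaussian E = ((2 * Real.pi) ^ (Module.finrank ℝ E / 2 : ℝ))⁻¹ *
      ∫ x, f x * Real.exp (-‖x‖ ^ 2 / 2) := by
  rw [stdGaussian_eq_withDensity, integral_withDensity_eq_integral_toReal_smul (by fun_prop)
    (by simp), ← integral_const_mul]
  simp_rw [fun x : E => ENNReal.toReal_ofReal (gaussianDensity_pos x).le, gaussianDensity]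
  congr 1
  ext x
  simp only [smul_eq_mul]
  ring

/-- Euler's identity for the standard Gaussian measure: for `f` homogeneous of degree `d` on a
space of dimension `N`, `E[‖x‖² f(x)] = (N + d) E[f(x)]`. -/
theorem integral_sq_norm_mul_of_homogeneous {f : E → ℝ} {d : ℤ}
    (hf : ∀ (c : ℝ) (x : E), 0 < c → f (c • x) = c ^ d * f x)
    (hint : Integrable f (stdGaussian E)) :
    Integrable (fun x => ‖x‖ ^ 2 * f x) (stdGaussian E) ∧
      ∫ x, ‖x‖ ^ 2 * f x ∂stdGaussian E = (Module.finrank ℝ E + d) * ∫ x, f x ∂stdGaussian E := by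
  rw [integrable_stdGaussian_iff] at hint ⊢
  rw [integral_stdGaussian_eq, integral_stdGaussian_eq]
  set N := Module.finrank ℝ E
  -- The substitution `x ↦ c • x` gives `∫ F c = c ^ (-(N + d)) * ∫ F 1`. Differentiating both sides
  -- at `c = 1`, on the left under the integral sign, gives the identity.
  set F : ℝ → E → ℝ := fun c x => f x * Real.exp (-c ^ 2 * ‖x‖ ^ 2 / 2) with hF
  have hF1 : F 1 = fun x => f x * Real.exp (-‖x‖ ^ 2 / 2) := by
    ext x
    simp [hF]
  have hscale : ∀ c : ℝ, 0 < c → ∀ x, F 1 (c • x) = c ^ d * F c x := by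
    intro c hc x
    simp only [hF, hf c x hc, norm_smul, Real.norm_eq_abs, abs_of_pos hc]
    rw [mul_assoc]
    congr 4
    ring
  have hFint : ∀ c : ℝ, 0 < c → Integrable (F c) := by
    intro c hc
    have h1 : Integrable fun x => F 1 (c • x) :=
      (integrable_comp_smul_iff volume (F 1) hc.ne').2 (hF1 ▸ hint)
    simp_rw [hscale c hc] at h1
    exact (integrable_const_mul_iff (isUnit_iff_ne_zero.2 (zpow_ne_zero d hc.ne')) _).1 h1
  have hG : ∀ c : ℝ, 0 < c → ∫ x, F c x = c ^ (-(N + d : ℤ)) * ∫ x, F 1 x := by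
    intro c hc
    have h1 := Measure.integral_comp_smul_of_nonneg (volume : Measure E) (F 1) c (hR := hc.le)
    simp_rw [hscale c hc] at h1
    rw [integral_const_mul, smul_eq_mul] at h1
    rw [neg_add, zpow_add₀ hc.ne', _root_.zpow_neg, _root_.zpow_neg, zpow_natCast, mul_right_comm, ← h1,
      mul_right_comm, mul_inv_cancel₀ (zpow_ne_zero d hc.ne'), one_mul]
  have hmeas : ∀ c : ℝ, 0 < c → AEStronglyMeasurable (F c) := fun c hc => (hFint c hc).1
  -- For `1/2 < c < 3/2` and `u = ‖x‖²`, `exp(-c²u/2) ≤ exp(-u/8) = exp(-u/32) exp(-3u/32)`. The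
  -- first factor belongs to `F (1/4)`; the second absorbs `c * u ≤ 16 * (3u/32)`.
  obtain ⟨hI, hD⟩ := hasDerivAt_integral_of_dominated_loc_of_deriv_le
    (μ := (volume : Measure E)) (F := F) (x₀ := (1 : ℝ)) (s := Set.Ioo (1 / 2) (3 / 2))
    (F' := fun c x => -c * ‖x‖ ^ 2 * F c x) (bound := fun x => 16 * ‖F (1 / 4) x‖)
    (Ioo_mem_nhds (by norm_num) (by norm_num))
    ((lt_mem_nhds zero_lt_one).mono hmeas) (hFint 1 one_pos)
    (by
      refine AEStronglyMeasurable.mul ?_ (hmeas 1 one_pos)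
      exact Measurable.aestronglyMeasurable (by fun_prop))
    (by
      refine Filter.Eventually.of_forall fun x c hc => ?_
      simp only [hF, norm_mul, norm_neg, norm_pow, Real.norm_eq_abs, Real.abs_exp, abs_norm]
      have hc0 : 0 < c := by linarith [hc.1]
      rw [abs_of_pos hc0]
      set u := ‖x‖ ^ 2 with hu
      have hu0 : 0 ≤ u := by positivity
      have h1 : Real.exp (-c ^ 2 * u / 2) ≤
          Real.exp (-(1 / 4) ^ 2 * u / 2) * Real.exp (-(3 / 32 * u)) := by
        rw [← Real.exp_add]
        apply Real.exp_le_exp.2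
        have : (1 / 4 : ℝ) ≤ c ^ 2 := by nlinarith [hc.1]
        nlinarith
      have h2 : 3 / 32 * u * Real.exp (-(3 / 32 * u)) ≤ 1 := by
        rw [Real.exp_neg, ← div_eq_mul_inv, div_le_one (Real.exp_pos _)]
        linarith [Real.add_one_le_exp (3 / 32 * u)]
      calc c * u * (|f x| * Real.exp (-c ^ 2 * u / 2))
          ≤ 3 / 2 * u * (|f x| *
            (Real.exp (-(1 / 4) ^ 2 * u / 2) * Real.exp (-(3 / 32 * u)))) := by
            gcongr
            exact hc.2.le
        _ = 16 * (|f x| * Real.exp (-(1 / 4) ^ 2 * u / 2)) *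
            (3 / 32 * u * Real.exp (-(3 / 32 * u))) := by ring
        _ ≤ 16 * (|f x| * Real.exp (-(1 / 4) ^ 2 * u / 2)) * 1 := by gcongr
        _ = _ := by ring)
    ((hFint _ (by norm_num)).norm.const_mul _)
    (by
      refine Filter.Eventually.of_forall fun x c hc => ?_
      have h1 : HasDerivAt (fun c : ℝ => -c ^ 2 * ‖x‖ ^ 2 / 2) (-c * ‖x‖ ^ 2) c := by
        have := (((hasDerivAt_pow 2 c).neg.mul_const (‖x‖ ^ 2)).div_const 2)
        refine this.congr_deriv ?_
        norm_num
        ring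
      exact (h1.exp.const_mul (f x)).congr_deriv (by simp only [hF]; ring))
  have hD' : HasDerivAt (fun c => ∫ x, F c x) (-(N + d : ℤ) * ∫ x, F 1 x) 1 := by
    have h1 := (hasDerivAt_zpow (-(N + d : ℤ)) (1 : ℝ) (Or.inl one_ne_zero)).mul_const
      (∫ x, F 1 x)
    refine (h1.congr_of_eventuallyEq ?_).congr_deriv (by simp)
    exact (lt_mem_nhds zero_lt_one).mono hG
  have heq := hD.unique hD'
  have hfun : ∀ x, -1 * ‖x‖ ^ 2 * F 1 x = -(‖x‖ ^ 2 * f x * Real.exp (-‖x‖ ^ 2 / 2)) := by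
    intro x
    rw [hF1]
    ring
  simp_rw [hfun] at heq hI
  rw [integral_neg, hF1] at heq
  refine ⟨by simpa using hI.neg, ?_⟩
  push_cast at heq
  rw [neg_eq_iff_eq_neg.1 heq]
  ring

theorem integral_sq_norm_stdGaussian :
    Integrable (fun x : E => ‖x‖ ^ 2) (stdGaussian E) ∧
      ∫ x : E, ‖x‖ ^ 2 ∂stdGaussian E = Module.finrank ℝ E := by
  simpa using integral_sq_norm_mul_of_homogeneous (E := E) (f := fun _ => 1) (d := 0) (by simp)
    (integrable_const 1)

theorem integral_norm_pow_four_stdGaussian :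
    Integrable (fun x : E => (‖x‖ ^ 2) ^ 2) (stdGaussian E) ∧
      ∫ x : E, (‖x‖ ^ 2) ^ 2 ∂stdGaussian E =
        Module.finrank ℝ E * (Module.finrank ℝ E + 2) := by
  have h := integral_sq_norm_stdGaussian (E := E)
  have := integral_sq_norm_mul_of_homogeneous (E := E) (f := fun x => ‖x‖ ^ 2) (d := 2)
    (fun c x _ => by simp [norm_smul, mul_pow]) h.1
  simp_rw [sq (‖_‖ ^ 2)]
  refine ⟨this.1, this.2.trans ?_⟩
  rw [h.2]
  push_cast
  ring

/-- In polar coordinates the radial integrand is `y ^ (N - 1 - k) * exp(-y²/2)`, with a nonnegative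
exponent. -/
theorem integrable_inv_norm_pow_stdGaussian {k : ℕ} (hk : k < Module.finrank ℝ E) :
    Integrable (fun x : E => (‖x‖ ^ k)⁻¹) (stdGaussian E) := by
  have : Nontrivial E := Module.nontrivial_of_finrank_pos (R := ℝ) (by omega)
  rw [integrable_stdGaussian_iff, integrable_fun_norm_addHaar
    (f := fun y : ℝ => (y ^ k)⁻¹ * Real.exp (-y ^ 2 / 2)) volume]
  have h := integrableOn_rpow_mul_exp_neg_mul_sq (b := 1 / 2) (by norm_num)
    (s := ((Module.finrank ℝ E - 1 - k : ℕ) : ℝ))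
    (lt_of_lt_of_le (by norm_num) (Nat.cast_nonneg _))
  refine h.congr_fun (fun y hy => ?_) measurableSet_Ioi
  have hy0 : (y : ℝ) ≠ 0 := (Set.mem_Ioi.1 hy).ne'
  dsimp only
  rw [Real.rpow_natCast, pow_sub₀ y hy0 (by omega), smul_eq_mul, mul_assoc]
  congr 3
  ring_nf

theorem ae_ne_zero_stdGaussian [Nontrivial E] : ∀ᵐ x ∂stdGaussian E, x ≠ 0 := by
  rw [stdGaussian_eq_withDensity]
  refine (withDensity_absolutelyContinuous _ _).ae_le ?_
  exact Measure.ae_ne volume 0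

/-- Euler's identity for `‖x‖⁻²`, of degree -2, reads `1 = (N - 2) E[‖x‖⁻²]`. -/
theorem integral_inv_sq_norm_stdGaussian (hE : 2 < Module.finrank ℝ E) :
    Integrable (fun x : E => (‖x‖ ^ 2)⁻¹) (stdGaussian E) ∧
      ∫ x : E, (‖x‖ ^ 2)⁻¹ ∂stdGaussian E = ((Module.finrank ℝ E : ℝ) - 2)⁻¹ := by
  have : Nontrivial E := Module.nontrivial_of_finrank_pos (R := ℝ) (by omega)
  have hi := integrable_inv_norm_pow_stdGaussian (E := E) hE
  refine ⟨hi, ?_⟩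
  have h := (integral_sq_norm_mul_of_homogeneous (E := E) (d := -2)
    (fun c x _ => by simp [norm_smul, mul_pow, _root_.zpow_neg, mul_comm]) hi).2
  have h1 : ∫ x : E, ‖x‖ ^ 2 * (‖x‖ ^ 2)⁻¹ ∂stdGaussian E = 1 := by
    rw [integral_congr_ae (g := fun _ => 1)]
    · simp
    · filter_upwards [ae_ne_zero_stdGaussian (E := E)] with x hx
      exact mul_inv_cancel₀ (by simpa using hx)
  rw [h1] at h
  refine eq_inv_of_mul_eq_one_right ?_
  rw [h]
  push_cast
  ring

/-- Euler's identity for `‖x‖⁻⁴`, of degree -4, reduces this to the mean of `‖x‖⁻²`. -/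
theorem integral_inv_norm_pow_four_stdGaussian (hE : 4 < Module.finrank ℝ E) :
    Integrable (fun x : E => ((‖x‖ ^ 2)⁻¹) ^ 2) (stdGaussian E) ∧
      ∫ x : E, ((‖x‖ ^ 2)⁻¹) ^ 2 ∂stdGaussian E =
        (((Module.finrank ℝ E : ℝ) - 2) * ((Module.finrank ℝ E : ℝ) - 4))⁻¹ := by
  have : Nontrivial E := Module.nontrivial_of_finrank_pos (R := ℝ) (by omega)
  have hi : Integrable (fun x : E => ((‖x‖ ^ 2)⁻¹) ^ 2) (stdGaussian E) := by
    simpa only [← inv_pow, ← pow_mul] using integrable_inv_norm_pow_stdGaussian (E := E) hE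
  refine ⟨hi, ?_⟩
  have h := (integral_sq_norm_mul_of_homogeneous (E := E) (d := -4)
    (fun c x _ => by
      simp only [norm_smul, mul_pow, _root_.zpow_neg, Real.norm_eq_abs, sq_abs, mul_inv, ← pow_mul,
        inv_pow]
      norm_cast) hi).2
  have h1 : ∫ x : E, ‖x‖ ^ 2 * ((‖x‖ ^ 2)⁻¹) ^ 2 ∂stdGaussian E =
      ((Module.finrank ℝ E : ℝ) - 2)⁻¹ := by
    rw [← (integral_inv_sq_norm_stdGaussian (E := E) (by omega)).2]
    refine integral_congr_ae ?_
    filter_upwards [ae_ne_zero_stdGaussian (E := E)] with x hx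
    have : ‖x‖ ≠ 0 := by simpa using hx
    field_simp
  rw [h1] at h
  have h4 : (4 : ℝ) < Module.finrank ℝ E := by exact_mod_cast hE
  rw [mul_inv, h]
  push_cast
  rw [mul_right_comm, ← sub_eq_add_neg, mul_inv_cancel₀ (by linarith), one_mul]

/-- The orthogonal projection of a standard Gaussian vector is a standard Gaussian vector. -/
theorem stdGaussian_map_orthogonalProjection (W : Submodule ℝ E) :
    (stdGaussian E).map W.orthogonalProjectionOnto = stdGaussian W := by
  apply Measure.ext_of_charFun
  ext t
  have h := charFun_stdGaussian (t : E)
  rw [charFun_apply] at h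
  rw [charFun_stdGaussian, charFun_apply, integral_map (by fun_prop)
    (Measurable.aestronglyMeasurable (by fun_prop))]
  simp_rw [W.inner_orthogonalProjectionOnto_eq_of_mem_right]
  rw [h]
  simp

theorem stdGaussian_submodule_eq_zero {W : Submodule ℝ E} (hW : W ≠ ⊤) :
    stdGaussian E W = 0 := by
  rw [stdGaussian_eq_withDensity]
  exact withDensity_absolutelyContinuous _ _ (Measure.addHaar_submodule _ _ hW)

/-- The product of standard Gaussian measures is the standard Gaussian measure of the product. -/
theorem pi_stdGaussian_map_toLp (ι : Type*) [Fintype ι] :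
    (Measure.pi fun _ : ι => stdGaussian E).map (WithLp.toLp 2) =
      stdGaussian (PiLp 2 fun _ : ι => E) := by
  apply Measure.ext_of_charFun (E := PiLp 2 fun _ : ι => E)
  ext t
  simp_rw [charFun_stdGaussian, charFun_pi, charFun_stdGaussian, ← Complex.exp_sum,
    ← Complex.ofReal_pow, PiLp.norm_sq_eq_of_L2]
  push_cast
  rw [← Finset.sum_neg_distrib, Finset.sum_div]

end StdGaussian

/-! ### Conditioning on all but one vector, by resampling that vector. -/

section Resampling

variable {ι α : Type*} [DecidableEq ι] [MeasurableSpace α]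

theorem measurable_update_prod (i : ι) :
    Measurable fun z : (ι → α) × α => Function.update z.1 i z.2 := by
  refine measurable_pi_iff.2 fun k => ?_
  by_cases h : k = i
  · subst h
    simpa using measurable_snd
  · simpa [Function.update_of_ne h, Function.comp_def] using
      (measurable_pi_apply k).comp (measurable_fst (α := ι → α) (β := α))

variable [Fintype ι]

/-- Replacing one coordinate of an i.i.d. family by an independent copy preserves its law. -/
theorem pi_prod_map_update (γ : Measure α) [IsProbabilityMeasure γ] (i : ι) :
    ((Measure.pi fun _ : ι => γ).prod γ).map (fun z => Function.update z.1 i z.2) =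
      Measure.pi fun _ : ι => γ := by
  symm
  refine Measure.pi_eq fun s hs => ?_
  rw [Measure.map_apply (measurable_update_prod i) (MeasurableSet.univ_pi hs)]
  -- The old `i`-th coordinate is discarded, hence unconstrained; its factor has mass 1.
  have h : (fun z : (ι → α) × α => Function.update z.1 i z.2) ⁻¹' Set.univ.pi s =
      (Set.univ.pi (Function.update s i Set.univ)) ×ˢ s i := by
    ext z
    simp only [Set.mem_preimage, Set.mem_pi, Set.mem_univ, true_imp_iff, Set.mem_prod]
    constructor
    · refine fun H => ⟨fun k => ?_, by simpa using H i⟩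
      by_cases hk : k = i
      · subst hk; simp
      · simpa [Function.update_of_ne hk] using H k
    · rintro ⟨H, Hi⟩ k
      by_cases hk : k = i
      · subst hk; simpa using Hi
      · simpa [Function.update_of_ne hk] using H k
  rw [h, Measure.prod_prod, Measure.pi_pi, ← Finset.mul_prod_erase _ _ (Finset.mem_univ i),
    ← Finset.mul_prod_erase (Finset.univ) (fun k => γ (s k)) (Finset.mem_univ i), mul_comm]
  simp only [Function.update_self, measure_univ, one_mul]
  congr 1
  refine Finset.prod_congr rfl fun k hk => ?_
  rw [Function.update_of_ne (Finset.ne_of_mem_erase hk)]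

theorem ae_ae_update {γ : Measure α} [IsProbabilityMeasure γ] (i : ι) {q : (ι → α) → Prop}
    (h : ∀ᵐ x ∂(Measure.pi fun _ : ι => γ), q x) :
    ∀ᵐ x ∂(Measure.pi fun _ : ι => γ), ∀ᵐ y ∂γ, q (Function.update x i y) := by
  rw [← pi_prod_map_update γ i] at h
  exact Measure.ae_ae_of_ae_prod (ae_of_ae_map (measurable_update_prod i).aemeasurable h)

theorem ae_of_ae_ae_update {γ : Measure α} [IsProbabilityMeasure γ] (i : ι) {q : (ι → α) → Prop}
    (hq : MeasurableSet {x | q x})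
    (h : ∀ᵐ x ∂(Measure.pi fun _ : ι => γ), ∀ᵐ y ∂γ, q (Function.update x i y)) :
    ∀ᵐ x ∂(Measure.pi fun _ : ι => γ), q x := by
  rw [← pi_prod_map_update γ i, ae_map_iff (measurable_update_prod i).aemeasurable hq]
  exact (Measure.ae_prod_iff_ae_ae (measurable_update_prod i hq)).2 h

/-- Plays the role of the tower property: the inner integral is the conditional expectation given
the coordinates other than `i`. -/
theorem lintegral_pi_eq_lintegral_update (γ : Measure α) [IsProbabilityMeasure γ] (i : ι)
    {f : (ι → α) → ENNReal} (hf : AEMeasurable f (Measure.pi fun _ : ι => γ)) :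
    ∫⁻ x, f x ∂(Measure.pi fun _ : ι => γ) =
      ∫⁻ x, ∫⁻ y, f (Function.update x i y) ∂γ ∂(Measure.pi fun _ : ι => γ) := by
  have hf' := hf
  rw [← pi_prod_map_update γ i] at hf'
  conv_lhs => rw [← pi_prod_map_update γ i]
  rw [lintegral_map' hf' (measurable_update_prod i).aemeasurable, lintegral_prod]
  exact hf'.comp_aemeasurable (measurable_update_prod i).aemeasurable

end Resampling

/-! ### Inverse Gram matrices and distances to spans. -/

instance borelSpace_realMatrix {ι κ : Type*} [Finite ι] [Finite κ] :
    BorelSpace (Matrix ι κ ℝ) :=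
  inferInstanceAs (BorelSpace (ι → κ → ℝ))

section Gram

variable {ι E : Type*} [NormedAddCommGroup E] [InnerProductSpace ℝ E] {x : ι → E}

theorem measurable_matrix_apply (i j : ι) : Measurable fun S : Matrix ι ι ℝ => S i j :=
  (measurable_pi_apply j).comp (measurable_pi_apply i)

theorem mem_span_orthogonal {s : Set ι} {z : E} (h : ∀ k ∈ s, inner ℝ z (x k) = (0 : ℝ)) :
    z ∈ (Submodule.span ℝ (x '' s))ᗮ := by
  rw [Submodule.mem_orthogonal']
  intro u hu
  induction hu using Submodule.span_induction with
  | mem u hu =>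
    obtain ⟨k, hk, rfl⟩ := hu
    exact h k hk
  | zero => simp
  | add u v _ _ hu hv => rw [inner_add_right, hu, hv, add_zero]
  | smul c u _ hu => rw [inner_smul_right, hu, mul_zero]

variable [Fintype ι] [DecidableEq ι]

theorem measurable_matrix_inv : Measurable fun S : Matrix ι ι ℝ => S⁻¹ := by
  simp_rw [Matrix.inv_def, Ring.inverse_eq_inv']
  refine measurable_pi_iff.2 fun i => measurable_pi_iff.2 fun j => ?_
  simp only [Matrix.smul_apply, smul_eq_mul]
  refine (Continuous.measurable (by fun_prop)).inv.mul (Continuous.measurable ?_)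
  exact (continuous_id.matrix_adjugate).matrix_elem i j

theorem gram_inv_symm (x : ι → E) (i j : ι) : (gram ℝ x)⁻¹ i j = (gram ℝ x)⁻¹ j i := by
  have h := (isHermitian_gram ℝ x).inv
  simpa using h.apply j i

/-- The dual family of `x`, whose Gram matrix is the inverse of the Gram matrix of `x`. -/
def gramDual (x : ι → E) (i : ι) : E := ∑ k, (gram ℝ x)⁻¹ i k • x k

theorem isUnit_det_gram (hx : LinearIndependent ℝ x) : IsUnit (gram ℝ x).det :=
  isUnit_iff_ne_zero.2 (det_gram_ne_zero_iff_linearIndependent.2 hx)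

theorem inner_gramDual (hx : LinearIndependent ℝ x) (i j : ι) :
    inner ℝ (gramDual x i) (x j) = (1 : Matrix ι ι ℝ) i j := by
  rw [← Matrix.nonsing_inv_mul _ (isUnit_det_gram hx), gramDual, sum_inner, Matrix.mul_apply]
  simp [inner_smul_left]

theorem gram_inv_apply_self_pos (hx : LinearIndependent ℝ x) (i : ι) : 0 < (gram ℝ x)⁻¹ i i := by
  have h : (gram ℝ x)⁻¹.PosDef := (posDef_gram_iff_linearIndependent.2 hx).inv
  exact h.diag_pos

variable [FiniteDimensional ℝ E]

/-- Projecting `z = t u + w` onto `Wᗮ` fixes `z` and kills `w`, so `z` is `t` times the projection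
of `u`; pair this with `u`. -/
theorem mul_sq_norm_orthogonalProjectionOnto_eq_one {W : Submodule ℝ E} {t : ℝ} {u w z : E}
    (hz : z = t • u + w) (hw : w ∈ W) (hzW : z ∈ Wᗮ) (hzu : inner ℝ z u = (1 : ℝ)) :
    t * ‖Wᗮ.orthogonalProjectionOnto u‖ ^ 2 = 1 := by
  have h1 : z = t • (Wᗮ.orthogonalProjectionOnto u : E) := by
    have h2 := congrArg (fun v => (Wᗮ.orthogonalProjectionOnto v : E)) hz
    simp only [map_add, map_smul, Submodule.coe_add, Submodule.coe_smul] at h2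
    rw [Wᗮ.orthogonalProjectionOnto_mem_subspace_eq_self ⟨z, hzW⟩] at h2
    dsimp only at h2
    rw [h2, Submodule.orthogonalProjectionOnto_eq_zero_iff.2
      (Submodule.le_orthogonal_orthogonal W hw)]
    simp
  rw [← hzu, h1, inner_smul_left, ← Submodule.inner_orthogonalProjectionOnto_eq_of_mem_left,
    ← real_inner_self_eq_norm_sq]
  simp

/-- The `i`-th dual vector is orthogonal to every `x k` with `k ≠ i`, pairs to 1 with `x i`, and has
coefficient `T i i` on `x i`. -/
theorem gram_inv_apply_self (hx : LinearIndependent ℝ x) (i : ι) :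
    (gram ℝ x)⁻¹ i i =
      (‖(Submodule.span ℝ (x '' {i}ᶜ))ᗮ.orthogonalProjectionOnto (x i)‖ ^ 2)⁻¹ := by
  refine eq_inv_of_mul_eq_one_left (mul_sq_norm_orthogonalProjectionOnto_eq_one
    (z := gramDual x i) (w := ∑ k ∈ Finset.univ.erase i, (gram ℝ x)⁻¹ i k • x k) ?_ ?_ ?_ ?_)
  · exact (Finset.add_sum_erase _ _ (Finset.mem_univ i)).symm
  · refine Submodule.sum_mem _ fun k hk => Submodule.smul_mem _ _ (Submodule.subset_span ?_)
    exact ⟨k, by simpa using hk, rfl⟩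
  · refine mem_span_orthogonal fun k hk => ?_
    rw [inner_gramDual hx, Matrix.one_apply_ne (Ne.symm (by simpa using hk))]
  · rw [inner_gramDual hx, Matrix.one_apply_eq]

/-- Subtracting from the `j`-th dual vector the multiple of the `i`-th one that removes its `x i`
component leaves a vector of the span of the `x k`, `k ≠ i`, whose coefficient on `x j` is the Schur
complement. -/
theorem gram_inv_schur_complement (hx : LinearIndependent ℝ x) {i j : ι} (hij : i ≠ j) :
    (gram ℝ x)⁻¹ j j - (gram ℝ x)⁻¹ i j ^ 2 / (gram ℝ x)⁻¹ i i =
      (‖(Submodule.span ℝ (x '' {i, j}ᶜ))ᗮ.orthogonalProjectionOnto (x j)‖ ^ 2)⁻¹ := by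
  set T := (gram ℝ x)⁻¹ with hT
  have hpos : T i i ≠ 0 := (gram_inv_apply_self_pos hx i).ne'
  have hinner : ∀ k, inner ℝ (gramDual x j - (T i j / T i i) • gramDual x i) (x k) =
      (1 : Matrix ι ι ℝ) j k - T i j / T i i * (1 : Matrix ι ι ℝ) i k := by
    intro k
    rw [inner_sub_left, inner_smul_left, inner_gramDual hx, inner_gramDual hx]
    simp
  refine eq_inv_of_mul_eq_one_left (mul_sq_norm_orthogonalProjectionOnto_eq_one
    (z := gramDual x j - (T i j / T i i) • gramDual x i)
    (w := ∑ k ∈ (Finset.univ.erase j).erase i, (T j k - T i j / T i i * T i k) • x k) ?_ ?_ ?_ ?_)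
  · have h1 : gramDual x j - (T i j / T i i) • gramDual x i =
        ∑ k, (T j k - T i j / T i i * T i k) • x k := by
      simp only [gramDual, Finset.smul_sum, sub_smul, Finset.sum_sub_distrib, smul_smul, hT]
    have h2 : (T j i - T i j / T i i * T i i) • x i = 0 := by
      rw [div_mul_cancel₀ _ hpos, hT, gram_inv_symm x j i, sub_self, zero_smul]
    rw [h1, ← Finset.add_sum_erase _ _ (Finset.mem_univ j),
      ← Finset.add_sum_erase (Finset.univ.erase j) _ (Finset.mem_erase.2 ⟨hij, Finset.mem_univ i⟩),
      h2, zero_add]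
    congr 2
    ring
  · refine Submodule.sum_mem _ fun k hk => Submodule.smul_mem _ _ (Submodule.subset_span ?_)
    exact ⟨k, by simpa using hk, rfl⟩
  · refine mem_span_orthogonal fun k hk => ?_
    simp only [Set.mem_compl_iff, Set.mem_insert_iff, Set.mem_singleton_iff, not_or] at hk
    rw [hinner, Matrix.one_apply_ne (Ne.symm hk.2), Matrix.one_apply_ne (Ne.symm hk.1)]
    ring
  · rw [hinner, Matrix.one_apply_eq, Matrix.one_apply_ne hij]
    ring

/-- The additive form avoids truncated subtraction. -/
theorem finrank_span_orthogonal (hx : LinearIndependent ℝ x) {s : Finset ι} {t : Set ι}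
    (hst : (s : Set ι) = t) :
    Module.finrank ℝ ((Submodule.span ℝ (x '' tᶜ))ᗮ : Submodule ℝ E) + Fintype.card ι =
      Module.finrank ℝ E + s.card := by
  subst hst
  have h1 := (Submodule.span ℝ (x '' (s : Set ι)ᶜ)).finrank_add_finrank_orthogonal
  have h2 : Module.finrank ℝ (Submodule.span ℝ (x '' (s : Set ι)ᶜ)) = sᶜ.card := by
    have h3 := finrank_span_eq_card (R := ℝ)
      (hx.comp (Subtype.val : ((sᶜ : Finset ι) : Set ι) → ι) Subtype.val_injective)
    rw [Set.range_comp, Subtype.range_coe] at h3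
    rw [← Finset.coe_compl, h3]
    simp [Finset.card_compl]
  rw [h2] at h1
  have h4 := Finset.card_add_card_compl s
  omega

end Gram

theorem image_update_of_notMem {ι α : Type*} [DecidableEq ι] {s : Set ι} {i : ι} (hi : i ∉ s) (x : ι → α) (y : α) :
    Function.update x i y '' s = x '' s :=
  Set.image_congr fun _ hk => Function.update_of_ne (ne_of_mem_of_not_mem hk hi) _ _

theorem span_image_finset_ne_top {ι E : Type*} [NormedAddCommGroup E]
    [InnerProductSpace ℝ E] {x : ι → E} {s : Finset ι} (hs : s.card < Module.finrank ℝ E) :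
    Submodule.span ℝ (x '' s) ≠ ⊤ := by
  classical
  intro h
  have h1 := finrank_span_finset_le_card (R := ℝ) (s.image x)
  rw [Finset.coe_image, Set.finrank, h, finrank_top] at h1
  exact absurd (h1.trans Finset.card_image_le) (by omega)

/-! ### Moments of the inverse Gram matrix of a Gaussian family. -/

section GaussianFamily

/-- The law of a family of independent standard Gaussian vectors. -/
abbrev gaussianFamily (ι E : Type*) [Fintype ι] [NormedAddCommGroup E] [InnerProductSpace ℝ E]
    [FiniteDimensional ℝ E] [MeasurableSpace E] : Measure (ι → E) :=
  Measure.pi fun _ => stdGaussian E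

variable {ι E : Type*} [NormedAddCommGroup E] [InnerProductSpace ℝ E]
  [FiniteDimensional ℝ E] [MeasurableSpace E] [BorelSpace E]

theorem measurable_gram : Measurable fun x : ι → E => gram ℝ x := by
  refine measurable_pi_iff.2 fun i => measurable_pi_iff.2 fun j => ?_
  simp only [gram_apply]
  fun_prop

theorem lintegral_inv_sq_norm_orthogonalProjectionOnto (W : Submodule ℝ E)
    (hW : 2 < Module.finrank ℝ W) :
    ∫⁻ y, ENNReal.ofReal ((‖W.orthogonalProjectionOnto y‖ ^ 2)⁻¹) ∂stdGaussian E =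
      ENNReal.ofReal ((Module.finrank ℝ W - 2 : ℝ)⁻¹) := by
  obtain ⟨h1, h2⟩ := integral_inv_sq_norm_stdGaussian hW
  rw [← h2, ofReal_integral_eq_lintegral_ofReal h1
    (Filter.Eventually.of_forall fun _ => by positivity), ← stdGaussian_map_orthogonalProjection W,
    lintegral_map (by fun_prop) (by fun_prop)]

theorem lintegral_inv_norm_pow_four_orthogonalProjectionOnto (W : Submodule ℝ E)
    (hW : 4 < Module.finrank ℝ W) :
    ∫⁻ y, ENNReal.ofReal (((‖W.orthogonalProjectionOnto y‖ ^ 2)⁻¹) ^ 2) ∂stdGaussian E =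
      ENNReal.ofReal (((Module.finrank ℝ W - 2 : ℝ) * (Module.finrank ℝ W - 4 : ℝ))⁻¹) := by
  obtain ⟨h1, h2⟩ := integral_inv_norm_pow_four_stdGaussian hW
  rw [← h2, ofReal_integral_eq_lintegral_ofReal h1
    (Filter.Eventually.of_forall fun _ => by positivity), ← stdGaussian_map_orthogonalProjection W,
    lintegral_map (by fun_prop) (by fun_prop)]

variable [Fintype ι] [DecidableEq ι]

theorem measurableSet_linearIndepOn (s : Finset ι) :
    MeasurableSet {x : ι → E | LinearIndepOn ℝ x (s : Set ι)} := by
  have h : {x : ι → E | LinearIndepOn ℝ x (s : Set ι)} =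
      (fun x : ι → E => (gram ℝ fun k : (s : Set ι) => x k).det) ⁻¹' {0}ᶜ := by
    ext x
    exact det_gram_ne_zero_iff_linearIndependent.symm
  rw [h]
  refine Measurable.comp (g := fun S : Matrix (s : Set ι) (s : Set ι) ℝ => S.det)
    (f := fun x : ι → E => gram ℝ fun k : (s : Set ι) => x k)
    (Continuous.measurable (by fun_prop)) ?_ (measurableSet_singleton _).compl
  exact measurable_gram.comp (measurable_pi_iff.2 fun k => measurable_pi_apply _)

/-- Vectors are added one at a time: the span of the earlier ones is a proper subspace, which a
fresh Gaussian vector almost surely avoids. -/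
theorem ae_linearIndepOn (s : Finset ι) (hs : s.card ≤ Module.finrank ℝ E) :
    ∀ᵐ x ∂gaussianFamily ι E, LinearIndepOn ℝ x (s : Set ι) := by
  induction s using Finset.induction_on with
  | empty => simp
  | insert i s hi ih =>
    rw [Finset.card_insert_of_notMem hi] at hs
    refine ae_of_ae_ae_update i (measurableSet_linearIndepOn _) ?_
    filter_upwards [ih (by omega)] with x hx
    have h0 := stdGaussian_submodule_eq_zero (span_image_finset_ne_top (x := x) (s := s) (by omega))
    filter_upwards [measure_eq_zero_iff_ae_notMem.1 h0] with y hy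
    have hi' : i ∉ (s : Set ι) := by simpa using hi
    rw [Finset.coe_insert]
    refine LinearIndepOn.insert (hx.congr fun k hk => ?_) ?_
    · rw [Function.update_of_ne (ne_of_mem_of_not_mem hk hi')]
    · rwa [image_update_of_notMem hi', Function.update_self]

theorem ae_linearIndependent (h : Fintype.card ι ≤ Module.finrank ℝ E) :
    ∀ᵐ x ∂gaussianFamily ι E, LinearIndependent ℝ x := by
  filter_upwards [ae_linearIndepOn (E := E) (Finset.univ : Finset ι) (by simpa using h)] with x hx
  rwa [Finset.coe_univ, linearIndepOn_univ_iff] at hx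

theorem measurable_gram_inv_apply (i j : ι) : Measurable fun x : ι → E => (gram ℝ x)⁻¹ i j :=
  (measurable_matrix_apply i j).comp (measurable_matrix_inv.comp measurable_gram)

/-- Resampling `x i` leaves the span of the other vectors fixed, and the inner integral depends only
on the dimension `n - p + 1` of its orthogonal complement. -/
theorem lintegral_gram_inv_apply_self (h : Fintype.card ι ≤ Module.finrank ℝ E) (i : ι)
    {g : ℝ → ENNReal} (hg : Measurable g) {c : ENNReal}
    (hc : ∀ W : Submodule ℝ E, Module.finrank ℝ W + Fintype.card ι = Module.finrank ℝ E + 1 →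
      ∫⁻ y, g ((‖W.orthogonalProjectionOnto y‖ ^ 2)⁻¹) ∂stdGaussian E = c) :
    ∫⁻ x, g ((gram ℝ x)⁻¹ i i) ∂gaussianFamily ι E = c := by
  have hLI := ae_linearIndependent (E := E) h
  have hm : Measurable fun x : ι → E => g ((gram ℝ x)⁻¹ i i) :=
    hg.comp (measurable_gram_inv_apply i i)
  rw [lintegral_pi_eq_lintegral_update _ i hm.aemeasurable]
  have h1 : ∀ᵐ x ∂gaussianFamily ι E,
      ∫⁻ y, g ((gram ℝ (Function.update x i y))⁻¹ i i) ∂stdGaussian E = c := by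
    filter_upwards [hLI, ae_ae_update i hLI] with x hx hxy
    rw [← hc (Submodule.span ℝ (x '' {i}ᶜ))ᗮ
      (by simpa using finrank_span_orthogonal hx (s := {i}) (by simp))]
    refine lintegral_congr_ae ?_
    filter_upwards [hxy] with y hy
    rw [gram_inv_apply_self hy, image_update_of_notMem (by simp), Function.update_self]
  rw [lintegral_congr_ae h1]
  simp

theorem lintegral_gram_inv_schur_complement (h : Fintype.card ι ≤ Module.finrank ℝ E) {i j : ι}
    (hij : i ≠ j) {g : ℝ → ENNReal} (hg : Measurable g) {c : ENNReal}
    (hc : ∀ W : Submodule ℝ E, Module.finrank ℝ W + Fintype.card ι = Module.finrank ℝ E + 2 →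
      ∫⁻ y, g ((‖W.orthogonalProjectionOnto y‖ ^ 2)⁻¹) ∂stdGaussian E = c) :
    ∫⁻ x, g ((gram ℝ x)⁻¹ j j - (gram ℝ x)⁻¹ i j ^ 2 / (gram ℝ x)⁻¹ i i) ∂gaussianFamily ι E =
      c := by
  have hLI := ae_linearIndependent (E := E) h
  have hm : Measurable fun x : ι → E =>
      g ((gram ℝ x)⁻¹ j j - (gram ℝ x)⁻¹ i j ^ 2 / (gram ℝ x)⁻¹ i i) :=
    hg.comp ((measurable_gram_inv_apply j j).sub
      (((measurable_gram_inv_apply i j).pow_const 2).div (measurable_gram_inv_apply i i)))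
  rw [lintegral_pi_eq_lintegral_update _ j hm.aemeasurable]
  have h1 : ∀ᵐ x ∂gaussianFamily ι E,
      ∫⁻ y, g ((gram ℝ (Function.update x j y))⁻¹ j j - (gram ℝ (Function.update x j y))⁻¹ i j ^ 2 /
        (gram ℝ (Function.update x j y))⁻¹ i i) ∂stdGaussian E = c := by
    filter_upwards [hLI, ae_ae_update j hLI] with x hx hxy
    rw [← hc (Submodule.span ℝ (x '' {i, j}ᶜ))ᗮ
      (by simpa [Finset.card_pair hij] using
        finrank_span_orthogonal hx (s := {i, j}) (t := {i, j}) (by simp))]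
    refine lintegral_congr_ae ?_
    filter_upwards [hxy] with y hy
    rw [gram_inv_schur_complement hy hij, image_update_of_notMem (by simp), Function.update_self]
  rw [lintegral_congr_ae h1]
  simp

/-- The minor is `T i i` times the Schur complement, and the latter does not involve `x i`.
Integrating out `x i` gives the constant `1/(n-p-1)`; the Schur complement then contributes
`1/(n-p)`. -/
theorem lintegral_gram_inv_minor (h : Fintype.card ι + 1 < Module.finrank ℝ E) {i j : ι}
    (hij : i ≠ j) :
    ∫⁻ x, ENNReal.ofReal ((gram ℝ x)⁻¹ i i * (gram ℝ x)⁻¹ j j - (gram ℝ x)⁻¹ i j ^ 2)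
        ∂gaussianFamily ι E =
      ENNReal.ofReal (((Module.finrank ℝ E - Fintype.card ι : ℝ) *
        (Module.finrank ℝ E - Fintype.card ι - 1))⁻¹) := by
  have hLI := ae_linearIndependent (ι := ι) (E := E) (by omega)
  set c : ENNReal := ENNReal.ofReal ((Module.finrank ℝ E - Fintype.card ι - 1 : ℝ)⁻¹) with hc
  have hnp : (Fintype.card ι : ℝ) + 1 < Module.finrank ℝ E := by exact_mod_cast h
  have hm : Measurable fun x : ι → E => ENNReal.ofReal
      ((gram ℝ x)⁻¹ i i * (gram ℝ x)⁻¹ j j - (gram ℝ x)⁻¹ i j ^ 2) :=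
    ENNReal.measurable_ofReal.comp
      (((measurable_gram_inv_apply i i).mul (measurable_gram_inv_apply j j)).sub
        ((measurable_gram_inv_apply i j).pow_const 2))
  have hm' : Measurable fun x : ι → E => ENNReal.ofReal
      ((gram ℝ x)⁻¹ j j - (gram ℝ x)⁻¹ i j ^ 2 / (gram ℝ x)⁻¹ i i) :=
    ENNReal.measurable_ofReal.comp ((measurable_gram_inv_apply j j).sub
      (((measurable_gram_inv_apply i j).pow_const 2).div (measurable_gram_inv_apply i i)))
  rw [lintegral_pi_eq_lintegral_update _ i hm.aemeasurable]
  have h1 : ∀ᵐ x ∂gaussianFamily ι E,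
      ∫⁻ y, ENNReal.ofReal ((gram ℝ (Function.update x i y))⁻¹ i i *
        (gram ℝ (Function.update x i y))⁻¹ j j - (gram ℝ (Function.update x i y))⁻¹ i j ^ 2)
          ∂stdGaussian E =
      c * ENNReal.ofReal ((gram ℝ x)⁻¹ j j - (gram ℝ x)⁻¹ i j ^ 2 / (gram ℝ x)⁻¹ i i) := by
    filter_upwards [hLI, ae_ae_update i hLI] with x hx hxy
    have hdim : Module.finrank ℝ ((Submodule.span ℝ (x '' {i}ᶜ))ᗮ : Submodule ℝ E) +
        Fintype.card ι = Module.finrank ℝ E + 1 := by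
      simpa using finrank_span_orthogonal hx (s := {i}) (by simp)
    have hdim' : (Module.finrank ℝ ((Submodule.span ℝ (x '' {i}ᶜ))ᗮ : Submodule ℝ E) : ℝ) +
        Fintype.card ι = Module.finrank ℝ E + 1 := by exact_mod_cast hdim
    have h2 := lintegral_inv_sq_norm_orthogonalProjectionOnto
      (Submodule.span ℝ (x '' {i}ᶜ))ᗮ (by omega)
    rw [show (Module.finrank ℝ ((Submodule.span ℝ (x '' {i}ᶜ))ᗮ : Submodule ℝ E) : ℝ) - 2 =
      Module.finrank ℝ E - Fintype.card ι - 1 by linarith] at h2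
    rw [hc, ← h2, ← lintegral_mul_const _ (by fun_prop)]
    refine lintegral_congr_ae ?_
    filter_upwards [hxy] with y hy
    have h3 := (gram_inv_apply_self_pos hy i)
    have h4 : ∀ a b d : ℝ, 0 < a → a * b - d = a * (b - d / a) := by
      intro a b d ha
      field_simp
    rw [h4 _ _ _ h3, gram_inv_schur_complement hy hij, gram_inv_schur_complement hx hij,
      gram_inv_apply_self hy, image_update_of_notMem (by simp), Function.update_self,
      image_update_of_notMem (by simp), Function.update_of_ne hij.symm,
      ENNReal.ofReal_mul (by positivity)]
  rw [lintegral_congr_ae h1, lintegral_const_mul _ hm',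
    lintegral_gram_inv_schur_complement (by omega) hij ENNReal.measurable_ofReal
      (c := ENNReal.ofReal ((Module.finrank ℝ E - Fintype.card ι : ℝ)⁻¹)), hc,
    ← ENNReal.ofReal_mul (inv_nonneg.2 (by linarith)), mul_inv, mul_comm]
  intro W hW
  have hW' : (Module.finrank ℝ W : ℝ) + Fintype.card ι = Module.finrank ℝ E + 2 := by
    exact_mod_cast hW
  rw [lintegral_inv_sq_norm_orthogonalProjectionOnto W (by omega)]
  congr 2
  linarith

/-- Working with `∫⁻` lets Tonelli apply with no integrability hypothesis; integrability is
recovered here from the finite value. -/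
theorem integral_eq_of_lintegral_ofReal_eq {Ω : Type*} [MeasurableSpace Ω] {μ : Measure Ω}
    {f : Ω → ℝ} (hf : Measurable f) (hf0 : 0 ≤ᵐ[μ] f) {c : ℝ} (hc : 0 ≤ c)
    (h : ∫⁻ ω, ENNReal.ofReal (f ω) ∂μ = ENNReal.ofReal c) :
    Integrable f μ ∧ ∫ ω, f ω ∂μ = c := by
  constructor
  · exact (lintegral_ofReal_ne_top_iff_integrable hf.aestronglyMeasurable hf0).1 (by simp [h])
  · rw [integral_eq_lintegral_of_nonneg_ae hf0 hf.aestronglyMeasurable, h, ENNReal.toReal_ofReal hc]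

theorem integral_gram_inv_apply_self (h : Fintype.card ι + 1 < Module.finrank ℝ E) (i : ι) :
    Integrable (fun x : ι → E => (gram ℝ x)⁻¹ i i) (gaussianFamily ι E) ∧
      ∫ x, (gram ℝ x)⁻¹ i i ∂gaussianFamily ι E =
        (Module.finrank ℝ E - Fintype.card ι - 1 : ℝ)⁻¹ := by
  have hnp : (Fintype.card ι : ℝ) + 1 < Module.finrank ℝ E := by exact_mod_cast h
  refine integral_eq_of_lintegral_ofReal_eq (measurable_gram_inv_apply i i) ?_
    (inv_nonneg.2 (by linarith)) ?_
  · filter_upwards [ae_linearIndependent (ι := ι) (E := E) (by omega)] with x hx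
    exact (gram_inv_apply_self_pos hx i).le
  · refine lintegral_gram_inv_apply_self (by omega) i ENNReal.measurable_ofReal fun W hW => ?_
    have hW' : (Module.finrank ℝ W : ℝ) + Fintype.card ι = Module.finrank ℝ E + 1 := by
      exact_mod_cast hW
    rw [lintegral_inv_sq_norm_orthogonalProjectionOnto W (by omega)]
    congr 2
    linarith

/-- An inverse fourth power of the norm in dimension `n - p + 1` needs `n - p + 1 > 4`, whence the
hypothesis. -/
theorem integral_sq_gram_inv_apply_self (h : Fintype.card ι + 3 < Module.finrank ℝ E) (i : ι) :
    Integrable (fun x : ι → E => (gram ℝ x)⁻¹ i i ^ 2) (gaussianFamily ι E) ∧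
      ∫ x, (gram ℝ x)⁻¹ i i ^ 2 ∂gaussianFamily ι E =
        ((Module.finrank ℝ E - Fintype.card ι - 1 : ℝ) *
          (Module.finrank ℝ E - Fintype.card ι - 3 : ℝ))⁻¹ := by
  have hnp : (Fintype.card ι : ℝ) + 3 < Module.finrank ℝ E := by exact_mod_cast h
  refine integral_eq_of_lintegral_ofReal_eq ((measurable_gram_inv_apply i i).pow_const 2)
    (Filter.Eventually.of_forall fun x => sq_nonneg _)
    (inv_nonneg.2 (mul_nonneg (by linarith) (by linarith))) ?_
  refine lintegral_gram_inv_apply_self (by omega) i (g := fun t => ENNReal.ofReal (t ^ 2))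
    (by fun_prop) fun W hW => ?_
  have hW' : (Module.finrank ℝ W : ℝ) + Fintype.card ι = Module.finrank ℝ E + 1 := by
    exact_mod_cast hW
  rw [lintegral_inv_norm_pow_four_orthogonalProjectionOnto W (by omega)]
  congr 3 <;> linarith

theorem integral_gram_inv_minor (h : Fintype.card ι + 1 < Module.finrank ℝ E) {i j : ι}
    (hij : i ≠ j) :
    ∫ x, ((gram ℝ x)⁻¹ i i * (gram ℝ x)⁻¹ j j - (gram ℝ x)⁻¹ i j ^ 2) ∂gaussianFamily ι E =
      ((Module.finrank ℝ E - Fintype.card ι : ℝ) *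
        (Module.finrank ℝ E - Fintype.card ι - 1))⁻¹ := by
  have hnp : (Fintype.card ι : ℝ) + 1 < Module.finrank ℝ E := by exact_mod_cast h
  refine (integral_eq_of_lintegral_ofReal_eq (((measurable_gram_inv_apply i i).mul
    (measurable_gram_inv_apply j j)).sub ((measurable_gram_inv_apply i j).pow_const 2)) ?_
    (inv_nonneg.2 (mul_nonneg (by linarith) (by linarith)))
    (lintegral_gram_inv_minor h hij)).2
  filter_upwards [ae_linearIndependent (ι := ι) (E := E) (by omega)] with x hx
  have h1 := gram_inv_apply_self_pos hx i
  have h2 := gram_inv_schur_complement hx hij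
  have h3 : (0 : ℝ) ≤ (gram ℝ x)⁻¹ j j - (gram ℝ x)⁻¹ i j ^ 2 / (gram ℝ x)⁻¹ i i := by
    rw [h2]
    positivity
  have h4 := mul_nonneg h1.le h3
  rwa [mul_sub, mul_div_cancel₀ _ h1.ne'] at h4

end GaussianFamily

/-! ### Second moments of orthogonally invariant symmetric matrices. -/

section OrthogonallyInvariant

/-- The sign flip of the coordinate `a`. -/
def signFlip {ι : Type*} [DecidableEq ι] (a k : ι) : ℝ := if k = a then -1 else 1

theorem signFlip_mul_self {ι : Type*} [DecidableEq ι] (a k : ι) : signFlip a k * signFlip a k = 1 := by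
  unfold signFlip
  split_ifs <;> norm_num

variable {ι : Type*} [Fintype ι]

theorem measurable_conj (U : Matrix ι ι ℝ) : Measurable fun S : Matrix ι ι ℝ => Uᵀ * S * U :=
  Continuous.measurable (by fun_prop)

variable [DecidableEq ι]

/-- The law of a random matrix `S` is orthogonally invariant if `Uᵀ S U` has the law of `S` for
every orthogonal matrix `U`. -/
def IsOrthogonallyInvariant (ν : Measure (Matrix ι ι ℝ)) : Prop :=
  ∀ U : Matrix ι ι ℝ, Uᵀ * U = 1 → ν.map (fun S => Uᵀ * S * U) = ν

variable {ν : Measure (Matrix ι ι ℝ)}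

theorem IsOrthogonallyInvariant.integral_conj (hν : IsOrthogonallyInvariant ν)
    {U : Matrix ι ι ℝ} (hU : Uᵀ * U = 1) {g : Matrix ι ι ℝ → ℝ} (hg : Measurable g) :
    ∫ S, g (Uᵀ * S * U) ∂ν = ∫ S, g S ∂ν := by
  conv_rhs => rw [← hν U hU]
  rw [integral_map (measurable_conj U).aemeasurable hg.aestronglyMeasurable]

theorem IsOrthogonallyInvariant.integral_signFlip (hν : IsOrthogonallyInvariant ν) (a : ι)
    {g : Matrix ι ι ℝ → ℝ} (hg : Measurable g) :
    ∫ S, g (Matrix.of fun k l => signFlip a k * S k l * signFlip a l) ∂ν = ∫ S, g S ∂ν := by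
  rw [← hν.integral_conj (U := diagonal (signFlip a)) (by simp [signFlip_mul_self]) hg]
  congr 1
  ext S
  congr 1
  ext k l
  simp

theorem IsOrthogonallyInvariant.integral_apply_of_ne (hν : IsOrthogonallyInvariant ν) {i j : ι}
    (hij : i ≠ j) : ∫ S, S i j ∂ν = 0 := by
  have h := hν.integral_signFlip i (measurable_matrix_apply i j)
  simp only [Matrix.of_apply, signFlip, if_pos, if_neg hij.symm, neg_mul, one_mul, mul_one,
    integral_neg] at h
  linarith

theorem IsOrthogonallyInvariant.integral_mul_eq_zero (hν : IsOrthogonallyInvariant ν)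
    {a i j k l : ι} (h : signFlip a i * signFlip a j * signFlip a k * signFlip a l = -1) :
    ∫ S, S i j * S k l ∂ν = 0 := by
  have h1 := hν.integral_signFlip a
    ((measurable_matrix_apply i j).mul (measurable_matrix_apply k l))
  have h2 : ∀ S : Matrix ι ι ℝ, signFlip a i * S i j * signFlip a j *
      (signFlip a k * S k l * signFlip a l) = -(S i j * S k l) := by
    intro S
    linear_combination (S i j * S k l) * h
  simp only [Pi.mul_apply, Matrix.of_apply, h2, integral_neg] at h1
  linarith

/-- If the four indices cannot be paired off, one of them occurs an odd number of times, and
flipping that coordinate negates the integrand. -/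
theorem IsOrthogonallyInvariant.integral_mul_eq_zero_of_ne (hν : IsOrthogonallyInvariant ν)
    {i j k l : ι} (h1 : ¬(i = j ∧ k = l)) (h2 : ¬(i = k ∧ j = l)) (h3 : ¬(i = l ∧ j = k)) :
    ∫ S, S i j * S k l ∂ν = 0 := by
  have key : ∃ a, signFlip a i * signFlip a j * signFlip a k * signFlip a l = -1 := by
    by_cases hij : i = j
    · refine ⟨k, ?_⟩
      have : l ≠ k := fun h => h1 ⟨hij, h.symm⟩
      simp only [signFlip, hij, this, if_true, if_false]
      split_ifs <;> norm_num
    · by_cases hik : i = k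
      · refine ⟨j, ?_⟩
        have hjl : l ≠ j := fun h => h2 ⟨hik, h.symm⟩
        simp [signFlip, ← hik, hij, hjl]
      · by_cases hil : i = l
        · refine ⟨j, ?_⟩
          have hjk : k ≠ j := fun h => h3 ⟨hil, h.symm⟩
          simp [signFlip, ← hil, hij, hjk]
        · exact ⟨i, by simp [signFlip, Ne.symm hij, Ne.symm hik, Ne.symm hil]⟩
  obtain ⟨a, ha⟩ := key
  exact hν.integral_mul_eq_zero ha

/-- The reflection in the hyperplane orthogonal to `e i + 2 e j`. -/
def pairReflection (i j : ι) : Matrix ι ι ℝ :=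
  1 - (2 / 5 : ℝ) • vecMulVec (Pi.single i 1 + Pi.single j 2) (Pi.single i 1 + Pi.single j 2)

theorem pairReflection_orthogonal {i j : ι} (hij : i ≠ j) :
    (pairReflection i j)ᵀ * pairReflection i j = 1 := by
  set w : ι → ℝ := Pi.single i 1 + Pi.single j 2 with hw
  have hww : w ⬝ᵥ w = 5 := by
    simp [hw, hij, hij.symm]
    norm_num
  have h1 : vecMulVec w w * vecMulVec w w = (5 : ℝ) • vecMulVec w w := by
    rw [vecMulVec_mul_vecMulVec, hww]
    ext a b
    simp [vecMulVec_apply, mul_left_comm]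
  have h2 : (pairReflection i j)ᵀ = pairReflection i j := by
    simp [pairReflection, transpose_vecMulVec]
  rw [h2, pairReflection, ← hw, Matrix.sub_mul, Matrix.mul_sub, Matrix.mul_sub]
  simp only [Matrix.one_mul, Matrix.mul_one, Matrix.smul_mul, Matrix.mul_smul, h1, smul_smul]
  module

/-- Column `i` of the reflection is `(3/5, -4/5)` on the coordinates `i, j`: a rational orthogonal
matrix that mixes them without being a signed permutation. -/
theorem pairReflection_conj_apply {i j : ι} (hij : i ≠ j) (S : Matrix ι ι ℝ) :
    ((pairReflection i j)ᵀ * S * pairReflection i j) i i =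
      9 / 25 * S i i - 12 / 25 * (S i j + S j i) + 16 / 25 * S j j := by
  have hcol : ∀ k, pairReflection i j k i =
      (Pi.single i (3 / 5) + Pi.single j (-4 / 5) : ι → ℝ) k := by
    intro k
    by_cases hki : k = i
    · subst hki
      simp [pairReflection, vecMulVec_apply, hij]
      norm_num
    · by_cases hkj : k = j
      · subst hkj
        simp [pairReflection, vecMulVec_apply, hki, hij]
        norm_num
      · simp [pairReflection, vecMulVec_apply, hki, hkj]
  have h : ((pairReflection i j)ᵀ * S * pairReflection i j) i i =
      (fun k => pairReflection i j k i) ⬝ᵥ S *ᵥ (fun k => pairReflection i j k i) := by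
    rw [dotProduct_mulVec]
    rfl
  rw [h, show (fun k => pairReflection i j k i) =
    (Pi.single i (3 / 5) + Pi.single j (-4 / 5) : ι → ℝ) from funext hcol]
  simp [mulVec_add, add_dotProduct]
  ring

/-- Invariance of `E[S_ii²]` under the reflection. Terms odd in `S i j` vanish, leaving `(81 + 256)
A + 288 E[S_ii S_jj] + 576 C = 625 A`, where `C = E[S_ij²]`; divide by 288. -/
theorem IsOrthogonallyInvariant.integral_diag_mul_diag (hν : IsOrthogonallyInvariant ν)
    (hsymm : ∀ᵐ S ∂ν, ∀ i j, S i j = S j i)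
    (hint : ∀ i j k l, Integrable (fun S : Matrix ι ι ℝ => S i j * S k l) ν) {A : ℝ}
    (hA : ∀ i, ∫ S, S i i * S i i ∂ν = A) {i j : ι} (hij : i ≠ j) :
    ∫ S, S i i * S j j ∂ν + 2 * ∫ S, S i j * S i j ∂ν = A := by
  have h1 := hν.integral_conj (pairReflection_orthogonal hij)
    ((measurable_matrix_apply i i).mul (measurable_matrix_apply i i))
  simp only [Pi.mul_apply, pairReflection_conj_apply hij] at h1
  rw [hA] at h1
  have hz1 : ∫ S, S i i * S i j ∂ν = 0 :=
    hν.integral_mul_eq_zero_of_ne (by simp [hij]) (by simp [hij]) (by simp [hij])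
  have hz2 : ∫ S, S i j * S j j ∂ν = 0 :=
    hν.integral_mul_eq_zero_of_ne (by simp [hij]) (by simp [hij]) (by simp [hij])
  have h2 : ∫ S : Matrix ι ι ℝ, (9 / 25 * S i i - 12 / 25 * (S i j + S j i) + 16 / 25 * S j j) *
      (9 / 25 * S i i - 12 / 25 * (S i j + S j i) + 16 / 25 * S j j) ∂ν =
      ∫ S : Matrix ι ι ℝ, (81 / 625 * (S i i * S i i) + 256 / 625 * (S j j * S j j) +
        288 / 625 * (S i i * S j j) + 576 / 625 * (S i j * S i j) +
        (-432 / 625) * (S i i * S i j) + (-768 / 625) * (S i j * S j j)) ∂ν := by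
    refine integral_congr_ae ?_
    filter_upwards [hsymm] with S hS
    rw [hS j i]
    ring
  have hi := fun (c : ℝ) i j k l => (hint i j k l).const_mul c
  rw [h2, integral_add, integral_add, integral_add, integral_add, integral_add] at h1
  · simp only [integral_const_mul, hA, hz1, hz2] at h1
    linarith
  · exact hi _ _ _ _ _
  · exact hi _ _ _ _ _
  · exact (hi _ _ _ _ _).add (hi _ _ _ _ _)
  · exact hi _ _ _ _ _
  · exact ((hi _ _ _ _ _).add (hi _ _ _ _ _)).add (hi _ _ _ _ _)
  · exact hi _ _ _ _ _
  · exact (((hi _ _ _ _ _).add (hi _ _ _ _ _)).add (hi _ _ _ _ _)).add (hi _ _ _ _ _)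
  · exact hi _ _ _ _ _
  · exact ((((hi _ _ _ _ _).add (hi _ _ _ _ _)).add (hi _ _ _ _ _)).add (hi _ _ _ _ _)).add
      (hi _ _ _ _ _)
  · exact hi _ _ _ _ _

/-- The second moments of an orthogonally invariant symmetric random matrix. -/
theorem IsOrthogonallyInvariant.integral_mul (hν : IsOrthogonallyInvariant ν)
    (hsymm : ∀ᵐ S ∂ν, ∀ i j, S i j = S j i)
    (hint : ∀ i j k l, Integrable (fun S : Matrix ι ι ℝ => S i j * S k l) ν) {A C : ℝ}
    (hA : ∀ i, ∫ S, S i i * S i i ∂ν = A) (hC : ∀ i j, i ≠ j → ∫ S, S i j * S i j ∂ν = C)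
    (i j k l : ι) :
    ∫ S, S i j * S k l ∂ν = (A - 2 * C) * ((1 : Matrix ι ι ℝ) i j * (1 : Matrix ι ι ℝ) k l) +
      C * ((1 : Matrix ι ι ℝ) i k * (1 : Matrix ι ι ℝ) j l +
        (1 : Matrix ι ι ℝ) i l * (1 : Matrix ι ι ℝ) j k) := by
  by_cases h1 : i = j ∧ k = l
  · obtain ⟨rfl, rfl⟩ := h1
    by_cases hik : i = k
    · subst hik
      rw [hA]
      simp
      ring
    · have h := hν.integral_diag_mul_diag hsymm hint hA hik
      rw [hC _ _ hik] at h
      simp [hik]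
      linarith
  · by_cases h2 : i = k ∧ j = l
    · obtain ⟨rfl, rfl⟩ := h2
      have hij : i ≠ j := fun h => h1 ⟨h, h⟩
      rw [hC _ _ hij]
      simp [hij]
    · by_cases h3 : i = l ∧ j = k
      · obtain ⟨rfl, rfl⟩ := h3
        have hij : i ≠ j := fun h => h1 ⟨h, h.symm⟩
        rw [← hC _ _ hij, integral_congr_ae (g := fun S : Matrix ι ι ℝ => S i j * S i j)]
        · simp [hij]
        · filter_upwards [hsymm] with S hS
          rw [hS j i]
      · rw [hν.integral_mul_eq_zero_of_ne h1 h2 h3]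
        have e1 : (1 : Matrix ι ι ℝ) i j * (1 : Matrix ι ι ℝ) k l = 0 := by
          simp only [Matrix.one_apply]
          split_ifs <;> simp_all
        have e2 : (1 : Matrix ι ι ℝ) i k * (1 : Matrix ι ι ℝ) j l = 0 := by
          simp only [Matrix.one_apply]
          split_ifs <;> simp_all
        have e3 : (1 : Matrix ι ι ℝ) i l * (1 : Matrix ι ι ℝ) j k = 0 := by
          simp only [Matrix.one_apply]
          split_ifs <;> simp_all
        rw [e1, e2, e3]
        ring

end OrthogonallyInvariant

/-! ### Isometries of Gaussian families: invariance, Euler's identity, transposition. -/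

section Isometry

variable {ι κ E F : Type*} [Fintype ι] [Fintype κ] [NormedAddCommGroup E] [InnerProductSpace ℝ E]
  [NormedAddCommGroup F] [InnerProductSpace ℝ F]

/-- Right multiplication of a matrix with columns `x` by the matrix `U`. -/
def mulRightLinear (E : Type*) [NormedAddCommGroup E] [InnerProductSpace ℝ E] (U : Matrix ι ι ℝ) :
    (PiLp 2 fun _ : ι => E) →ₗ[ℝ] PiLp 2 fun _ : ι => E where
  toFun x := WithLp.toLp 2 fun j => ∑ k, U k j • x k
  map_add' x y := by
    ext j
    simp [Finset.sum_add_distrib]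
  map_smul' c x := by
    ext j
    simp [Finset.smul_sum, smul_comm c]

theorem gram_mulRight (U : Matrix ι ι ℝ) (x : ι → E) :
    gram ℝ (fun j => ∑ k, U k j • x k) = Uᵀ * gram ℝ x * U := by
  ext a b
  simp only [gram_apply, sum_inner, inner_sum, inner_smul_left, inner_smul_right,
    Matrix.mul_apply, transpose_apply, Finset.sum_mul, Finset.mul_sum,
    RCLike.conj_to_real]
  refine Finset.sum_congr rfl fun k _ => Finset.sum_congr rfl fun l _ => ?_
  ring

theorem trace_gram (x : ι → E) : (gram ℝ x).trace = ∑ i, ‖x i‖ ^ 2 := by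
  simp [Matrix.trace, gram_apply]

variable [FiniteDimensional ℝ E] [FiniteDimensional ℝ F]

/-- Right multiplication by an orthogonal matrix as an isometry. -/
def mulRightIsometry [DecidableEq ι] (E : Type*) [NormedAddCommGroup E] [InnerProductSpace ℝ E]
    [FiniteDimensional ℝ E] {U : Matrix ι ι ℝ} (hU : Uᵀ * U = 1) :
    (PiLp 2 fun _ : ι => E) ≃ₗᵢ[ℝ] PiLp 2 fun _ : ι => E :=
  LinearIsometry.toLinearIsometryEquiv
    { toLinearMap := mulRightLinear E U
      norm_map' := fun x => by
        have h : ‖mulRightLinear E U x‖ ^ 2 = ‖x‖ ^ 2 := by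
          rw [PiLp.norm_sq_eq_of_L2, PiLp.norm_sq_eq_of_L2, ← trace_gram, ← trace_gram]
          have h1 := gram_mulRight U x.ofLp
          change (gram ℝ (fun j => ∑ k, U k j • x.ofLp k)).trace = _
          rw [h1, Matrix.trace_mul_comm, ← Matrix.mul_assoc, mul_eq_one_comm.1 hU, Matrix.one_mul]
        exact (sq_eq_sq₀ (norm_nonneg _) (norm_nonneg _)).1 h } rfl

variable [MeasurableSpace E] [BorelSpace E] [MeasurableSpace F] [BorelSpace F]

/-- The family is one standard Gaussian vector of the `ℓ²` product, so isometries preserve its law.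
The two index types may differ, as transposition requires. -/
theorem measurePreserving_gaussianFamily
    (e : (PiLp 2 fun _ : ι => E) ≃ₗᵢ[ℝ] PiLp 2 fun _ : κ => F) :
    MeasurePreserving (fun x : ι → E => (e (WithLp.toLp 2 x)).ofLp)
      (gaussianFamily ι E) (gaussianFamily κ F) := by
  have hm : Measurable fun x : ι → E => (e (WithLp.toLp 2 x)).ofLp := by fun_prop
  refine ⟨hm, ?_⟩
  have h := stdGaussian_map e
  rw [← pi_stdGaussian_map_toLp ι, ← pi_stdGaussian_map_toLp κ,
    Measure.map_map (by fun_prop) (by fun_prop)] at h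
  have h2 := congrArg (Measure.map (WithLp.ofLp : (PiLp 2 fun _ : κ => F) → κ → F)) h
  rw [Measure.map_map (by fun_prop) (by fun_prop), Measure.map_map (by fun_prop) (by fun_prop)]
    at h2
  simpa [Function.comp_def] using h2

theorem isOrthogonallyInvariant_map_gram [DecidableEq ι] :
    IsOrthogonallyInvariant ((gaussianFamily ι E).map (gram ℝ)) := by
  intro U hU
  have h := measurePreserving_gaussianFamily (mulRightIsometry E hU)
  rw [Measure.map_map (measurable_conj U) measurable_gram]
  conv_rhs => rw [← h.map_eq]
  rw [Measure.map_map measurable_gram h.measurable]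
  congr 1
  ext1 x
  exact (gram_mulRight U x).symm

theorem IsOrthogonallyInvariant.map_inv [DecidableEq ι] {ν : Measure (Matrix ι ι ℝ)}
    (hν : IsOrthogonallyInvariant ν) :
    IsOrthogonallyInvariant (ν.map fun S => S⁻¹) := by
  intro U hU
  rw [Measure.map_map (measurable_conj U) measurable_matrix_inv]
  conv_rhs => rw [← hν U hU]
  rw [Measure.map_map measurable_matrix_inv (measurable_conj U)]
  congr 1
  ext1 S
  have h1 : U⁻¹ = Uᵀ := Matrix.inv_eq_left_inv hU
  have h2 : (Uᵀ)⁻¹ = U := Matrix.inv_eq_left_inv (mul_eq_one_comm.1 hU)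
  simp only [Function.comp, Matrix.mul_inv_rev, h1, h2, Matrix.mul_assoc]

theorem integral_trace_gram_mul_of_homogeneous {f : (ι → E) → ℝ} {d : ℤ}
    (hf : ∀ (c : ℝ) (x : ι → E), 0 < c → f (c • x) = c ^ d * f x)
    (hint : Integrable f (gaussianFamily ι E)) :
    Integrable (fun x => (gram ℝ x).trace * f x) (gaussianFamily ι E) ∧
      ∫ x, (gram ℝ x).trace * f x ∂gaussianFamily ι E =
        (Module.finrank ℝ E * Fintype.card ι + d) * ∫ x, f x ∂gaussianFamily ι E := by
  have hmp : MeasurePreserving (MeasurableEquiv.toLp 2 (ι → E)) (gaussianFamily ι E)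
      (stdGaussian (PiLp 2 fun _ : ι => E)) := ⟨by fun_prop, pi_stdGaussian_map_toLp ι⟩
  have hemb := (MeasurableEquiv.toLp 2 (ι → E)).measurableEmbedding
  have hdim : Module.finrank ℝ (PiLp 2 fun _ : ι => E) = Module.finrank ℝ E * Fintype.card ι := by
    rw [(WithLp.linearEquiv 2 ℝ (ι → E)).finrank_eq, Module.finrank_pi_fintype]
    simp [mul_comm]
  have h := integral_sq_norm_mul_of_homogeneous (E := PiLp 2 fun _ : ι => E)
    (f := fun x => f x.ofLp) (d := d) (fun c x hc => hf c _ hc)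
    ((hmp.integrable_comp_emb hemb).1 hint)
  have h1 := (hmp.integrable_comp_emb hemb).2 h.1
  have h2 := h.2
  rw [← hmp.integral_comp hemb, ← hmp.integral_comp hemb, hdim] at h2
  simp only [Function.comp_def, MeasurableEquiv.coe_toLp, PiLp.norm_sq_eq_of_L2] at h1 h2
  simp only [trace_gram]
  refine ⟨h1, h2.trans ?_⟩
  push_cast
  rfl

end Isometry

/-- Transposition of data matrices, seen as families of rows and as families of columns. -/
def transposeIsometry (n p : ℕ) : (PiLp 2 fun _ : Fin n => EuclideanSpace ℝ (Fin p)) ≃ₗᵢ[ℝ]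
    PiLp 2 fun _ : Fin p => EuclideanSpace ℝ (Fin n) where
  toFun x := WithLp.toLp 2 fun i => WithLp.toLp 2 fun j => x j i
  invFun x := WithLp.toLp 2 fun j => WithLp.toLp 2 fun i => x i j
  left_inv _ := rfl
  right_inv _ := rfl
  map_add' _ _ := rfl
  map_smul' _ _ := rfl
  norm_map' x := by
    refine (sq_eq_sq₀ (norm_nonneg _) (norm_nonneg _)).1 ?_
    simp only [LinearEquiv.coe_mk, PiLp.norm_sq_eq_of_L2]
    exact Finset.sum_comm

theorem transposeIsometry_apply {n p : ℕ} (x : PiLp 2 fun _ : Fin n => EuclideanSpace ℝ (Fin p))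
    (i : Fin p) (j : Fin n) : transposeIsometry n p x i j = x j i := rfl

/-- Entry `(a, b)` of `∑ j, x_j x_jᵀ` is the inner product of rows `a` and `b` of the data matrix,
and these rows are again independent standard Gaussian vectors. -/
theorem wishart_one_eq (n p : ℕ) : wishart n (1 : Matrix (Fin p) (Fin p) ℝ) =
    (gaussianFamily (Fin p) (EuclideanSpace ℝ (Fin n))).map (gram ℝ) := by
  have h := measurePreserving_gaussianFamily (transposeIsometry n p)
  rw [wishart, multivariateGaussian_zero_one, ← h.map_eq, Measure.map_map measurable_gram
    h.measurable]
  congr 1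
  ext x a b
  simp [transposeIsometry_apply, gram_apply, PiLp.inner_apply, Matrix.sum_apply, vecMulVec_apply,
    mul_comm]

/-! ### Moment formulas restated on the underlying sample space. -/

section Pushforward

variable {ι Ω : Type*} [MeasurableSpace Ω] {μ : Measure Ω}
  {T : Ω → Matrix ι ι ℝ}

theorem integral_mul_map (hT : Measurable T) (i j k l : ι) :
    ∫ S, S i j * S k l ∂μ.map T = ∫ ω, T ω i j * T ω k l ∂μ :=
  integral_map hT.aemeasurable ((measurable_matrix_apply i j).mul
    (measurable_matrix_apply k l)).aestronglyMeasurable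

theorem integrable_mul_map (hT : Measurable T)
    (hint : ∀ i j k l, Integrable (fun ω => T ω i j * T ω k l) μ) (i j k l : ι) :
    Integrable (fun S : Matrix ι ι ℝ => S i j * S k l) (μ.map T) :=
  (integrable_map_measure ((measurable_matrix_apply i j).mul
    (measurable_matrix_apply k l)).aestronglyMeasurable hT.aemeasurable).2 (hint i j k l)

theorem ae_symm_map [Countable ι] (hT : Measurable T) (hsymm : ∀ ω i j, T ω i j = T ω j i) :
    ∀ᵐ S ∂μ.map T, ∀ i j, S i j = S j i := by
  refine (ae_map_iff hT.aemeasurable ?_).2 (Filter.Eventually.of_forall hsymm)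
  simp only [Set.ofPred_forall]
  exact MeasurableSet.iInter fun i => MeasurableSet.iInter fun j =>
    measurableSet_eq_fun (measurable_matrix_apply i j) (measurable_matrix_apply j i)

variable [Fintype ι] [DecidableEq ι]

theorem integral_apply_eq_of_isOrthogonallyInvariant (hT : Measurable T)
    (hν : IsOrthogonallyInvariant (μ.map T)) {a : ℝ} (ha : ∀ i, ∫ ω, T ω i i ∂μ = a) (i j : ι) :
    ∫ ω, T ω i j ∂μ = a * (1 : Matrix ι ι ℝ) i j := by
  by_cases h : i = j
  · subst h
    simp [ha]
  · rw [Matrix.one_apply_ne h, mul_zero, ← hν.integral_apply_of_ne h]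
    exact (integral_map hT.aemeasurable (measurable_matrix_apply i j).aestronglyMeasurable).symm

theorem integral_diag_mul_diag_of_isOrthogonallyInvariant (hT : Measurable T)
    (hν : IsOrthogonallyInvariant (μ.map T)) (hsymm : ∀ ω i j, T ω i j = T ω j i)
    (hint : ∀ i j k l, Integrable (fun ω => T ω i j * T ω k l) μ) {A : ℝ}
    (hA : ∀ i, ∫ ω, T ω i i * T ω i i ∂μ = A) {i j : ι} (hij : i ≠ j) :
    ∫ ω, T ω i i * T ω j j ∂μ + 2 * ∫ ω, T ω i j * T ω i j ∂μ = A := by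
  simpa only [integral_mul_map hT] using hν.integral_diag_mul_diag (ae_symm_map hT hsymm)
    (integrable_mul_map hT hint) (A := A) (fun i => by rw [integral_mul_map hT, hA]) hij

theorem integral_mul_of_isOrthogonallyInvariant (hT : Measurable T)
    (hν : IsOrthogonallyInvariant (μ.map T)) (hsymm : ∀ ω i j, T ω i j = T ω j i)
    (hint : ∀ i j k l, Integrable (fun ω => T ω i j * T ω k l) μ) {A C : ℝ}
    (hA : ∀ i, ∫ ω, T ω i i * T ω i i ∂μ = A)
    (hC : ∀ i j, i ≠ j → ∫ ω, T ω i j * T ω i j ∂μ = C) (i j k l : ι) :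
    ∫ ω, T ω i j * T ω k l ∂μ =
      (A - 2 * C) * ((1 : Matrix ι ι ℝ) i j * (1 : Matrix ι ι ℝ) k l) +
      C * ((1 : Matrix ι ι ℝ) i k * (1 : Matrix ι ι ℝ) j l +
        (1 : Matrix ι ι ℝ) i l * (1 : Matrix ι ι ℝ) j k) := by
  rw [← integral_mul_map hT]
  exact hν.integral_mul (ae_symm_map hT hsymm) (integrable_mul_map hT hint)
    (fun i => by rw [integral_mul_map hT, hA])
    (fun i j hij => by rw [integral_mul_map hT, hC i j hij]) i j k l

end Pushforward

/-- Singular matrices are included, both sides being 0 there, since Euler's identity asks for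
homogeneity at every point. -/
theorem inv_smul_matrix {ι : Type*} [Fintype ι] [DecidableEq ι] {k : ℝ} (hk : k ≠ 0)
    (S : Matrix ι ι ℝ) : (k • S)⁻¹ = k⁻¹ • S⁻¹ := by
  by_cases h : IsUnit S.det
  · refine Matrix.inv_eq_left_inv ?_
    rw [Matrix.smul_mul, Matrix.mul_smul, smul_smul, inv_mul_cancel₀ hk, one_smul,
      Matrix.nonsing_inv_mul _ h]
  · have h' : ¬IsUnit (k • S).det := by
      rw [Matrix.det_smul]
      simp only [isUnit_iff_ne_zero, ne_eq, not_not] at h ⊢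
      rw [h, mul_zero]
    rw [Matrix.nonsing_inv_apply_not_isUnit _ h, Matrix.nonsing_inv_apply_not_isUnit _ h',
      smul_zero]

/-! ### Moments of the Gram matrix, its normalization, and their inverses. -/

section Moments

variable {ι E : Type*} [NormedAddCommGroup E] [InnerProductSpace ℝ E]

theorem gram_smul (c : ℝ) (x : ι → E) : gram ℝ (c • x) = c ^ 2 • gram ℝ x := by
  ext i j
  simp [gram_apply, inner_smul_left, inner_smul_right, sq, mul_assoc]

variable [Fintype ι]

theorem abs_gram_le_trace (x : ι → E) (i j : ι) : |gram ℝ x i j| ≤ (gram ℝ x).trace := by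
  have h : ∀ k, ‖x k‖ ^ 2 ≤ (gram ℝ x).trace := fun k => by
    rw [trace_gram]
    exact Finset.single_le_sum (f := fun k => ‖x k‖ ^ 2) (fun _ _ => sq_nonneg _)
      (Finset.mem_univ k)
  rw [gram_apply]
  have h1 := abs_real_inner_le_norm (x i) (x j)
  nlinarith [h i, h j, sq_nonneg (‖x i‖ - ‖x j‖)]

theorem trace_gram_nonneg (x : ι → E) : 0 ≤ (gram ℝ x).trace := by
  rw [trace_gram]
  positivity

/-- The Gram matrix normalized to have unit trace. -/
def normalizedGram (x : ι → E) : Matrix ι ι ℝ := (gram ℝ x).trace⁻¹ • gram ℝ x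

/-- This survives a zero trace, because all entries are bounded by the trace and so vanish too. -/
theorem trace_mul_normalizedGram (x : ι → E) (i j : ι) :
    (gram ℝ x).trace * normalizedGram x i j = gram ℝ x i j := by
  have h := abs_gram_le_trace x i j
  simp only [normalizedGram, Matrix.smul_apply, smul_eq_mul]
  by_cases h0 : (gram ℝ x).trace = 0
  · rw [h0] at h ⊢
    rw [abs_nonpos_iff.1 h, zero_mul]
  · rw [mul_inv_cancel_left₀ h0]

theorem abs_normalizedGram_le_one (x : ι → E) (i j : ι) : |normalizedGram x i j| ≤ 1 := by
  simp only [normalizedGram, Matrix.smul_apply, smul_eq_mul, abs_mul, abs_inv,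
    abs_of_nonneg (trace_gram_nonneg x)]
  rw [← div_eq_inv_mul]
  exact div_le_one_of_le₀ (abs_gram_le_trace x i j) (trace_gram_nonneg x)

theorem normalizedGram_smul {c : ℝ} (hc : 0 < c) (x : ι → E) :
    normalizedGram (c • x) = normalizedGram x := by
  rw [normalizedGram, gram_smul, Matrix.trace_smul, smul_eq_mul, smul_smul, mul_inv,
    mul_right_comm, inv_mul_cancel₀ (by positivity), one_mul, normalizedGram]

variable [FiniteDimensional ℝ E]

/-- The Schur complement is nonnegative. This lets diagonal entries dominate off-diagonal ones in
the integrability proofs. -/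
theorem sq_gram_inv_le [DecidableEq ι] {x : ι → E} (hx : LinearIndependent ℝ x) (i j : ι) :
    (gram ℝ x)⁻¹ i j ^ 2 ≤ (gram ℝ x)⁻¹ i i * (gram ℝ x)⁻¹ j j := by
  by_cases hij : i = j
  · subst hij
    rw [sq]
  · have h1 := gram_inv_apply_self_pos hx i
    have h3 : (0 : ℝ) ≤ (gram ℝ x)⁻¹ j j - (gram ℝ x)⁻¹ i j ^ 2 / (gram ℝ x)⁻¹ i i := by
      rw [gram_inv_schur_complement hx hij]
      positivity
    have h4 := mul_nonneg h1.le h3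
    rw [mul_sub, mul_div_cancel₀ _ h1.ne'] at h4
    linarith

variable [MeasurableSpace E] [BorelSpace E]

theorem measurable_normalizedGram : Measurable (normalizedGram : (ι → E) → Matrix ι ι ℝ) := by
  refine measurable_pi_iff.2 fun i => measurable_pi_iff.2 fun j => ?_
  simp only [normalizedGram, Matrix.smul_apply, smul_eq_mul, trace_gram, gram_apply]
  fun_prop

theorem integrable_normalizedGram (i j : ι) :
    Integrable (fun x => normalizedGram x i j) (gaussianFamily ι E) :=
  Integrable.of_bound ((measurable_matrix_apply i j).comp
    measurable_normalizedGram).aestronglyMeasurable 1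
    (Filter.Eventually.of_forall fun x => abs_normalizedGram_le_one x i j)

theorem integrable_normalizedGram_mul (i j k l : ι) :
    Integrable (fun x => normalizedGram x i j * normalizedGram x k l) (gaussianFamily ι E) :=
  Integrable.of_bound (((measurable_matrix_apply i j).comp measurable_normalizedGram).mul
    ((measurable_matrix_apply k l).comp measurable_normalizedGram)).aestronglyMeasurable 1
    (Filter.Eventually.of_forall fun x => by
      rw [Real.norm_eq_abs, abs_mul]
      exact mul_le_one₀ (abs_normalizedGram_le_one x i j) (abs_nonneg _)
        (abs_normalizedGram_le_one x k l))

theorem integral_gram_eq (i j : ι) :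
    ∫ x, gram ℝ x i j ∂gaussianFamily ι E =
      Module.finrank ℝ E * Fintype.card ι * ∫ x, normalizedGram x i j ∂gaussianFamily ι E := by
  have h := (integral_trace_gram_mul_of_homogeneous (E := E) (d := 0)
    (fun c x hc => by rw [normalizedGram_smul hc, zpow_zero, one_mul])
    (integrable_normalizedGram i j)).2
  simpa only [trace_mul_normalizedGram, Int.cast_zero, add_zero] using h

/-- Euler's identity twice, in degree 0 and then in degree 2 after one factor of the trace.
Integrability comes along, since it starts from a bounded function. -/
theorem integral_gram_mul_eq (i j k l : ι) :
    Integrable (fun x => gram ℝ x i j * gram ℝ x k l) (gaussianFamily ι E) ∧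
    ∫ x, gram ℝ x i j * gram ℝ x k l ∂gaussianFamily ι E =
      (Module.finrank ℝ E * Fintype.card ι + 2) * (Module.finrank ℝ E * Fintype.card ι) *
        ∫ x, normalizedGram x i j * normalizedGram x k l ∂gaussianFamily ι E := by
  obtain ⟨h1, h2⟩ := integral_trace_gram_mul_of_homogeneous (E := E) (d := 0)
    (fun c x hc => by rw [normalizedGram_smul hc, zpow_zero, one_mul])
    (integrable_normalizedGram_mul i j k l)
  obtain ⟨h3, h4⟩ := integral_trace_gram_mul_of_homogeneous (E := E) (d := 2)
    (fun c x hc => by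
      rw [normalizedGram_smul hc, gram_smul, Matrix.trace_smul, smul_eq_mul, mul_assoc]
      norm_cast) h1
  have h5 : ∀ x : ι → E, (gram ℝ x).trace * ((gram ℝ x).trace *
      (normalizedGram x i j * normalizedGram x k l)) = gram ℝ x i j * gram ℝ x k l := by
    intro x
    rw [← trace_mul_normalizedGram x i j, ← trace_mul_normalizedGram x k l]
    ring
  simp only [h5] at h3 h4
  refine ⟨h3, ?_⟩
  rw [h4, h2]
  push_cast
  ring

variable [DecidableEq ι]

theorem integral_gram (i j : ι) :
    ∫ x, gram ℝ x i j ∂gaussianFamily ι E = Module.finrank ℝ E * (1 : Matrix ι ι ℝ) i j := by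
  refine integral_apply_eq_of_isOrthogonallyInvariant measurable_gram
    isOrthogonallyInvariant_map_gram (fun i => ?_) i j
  simp only [gram_apply, real_inner_self_eq_norm_sq]
  rw [integral_comp_eval (μ := fun _ : ι => stdGaussian E) (f := fun y : E => ‖y‖ ^ 2)
    (Measurable.aestronglyMeasurable (by fun_prop))]
  exact integral_sq_norm_stdGaussian.2

theorem integral_gram_diag_mul_diag {i j : ι} (hij : i ≠ j) :
    ∫ x, gram ℝ x i i * gram ℝ x j j ∂gaussianFamily ι E = (Module.finrank ℝ E : ℝ) ^ 2 := by
  -- Independence of `x i` and `x j`, with the constant factor 1 at every other index.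
  have h := integral_fintype_prod_eq_prod (μ := fun _ : ι => stdGaussian E)
    (f := fun k (y : E) => if k ∈ ({i, j} : Finset ι) then ‖y‖ ^ 2 else (1 : ℝ))
  have h1 : ∀ k, ∫ y : E, (if k ∈ ({i, j} : Finset ι) then ‖y‖ ^ 2 else (1 : ℝ)) ∂stdGaussian E =
      if k ∈ ({i, j} : Finset ι) then (Module.finrank ℝ E : ℝ) else 1 := by
    intro k
    split_ifs
    · exact integral_sq_norm_stdGaussian.2
    · simp
  simp_rw [h1] at h
  simp only [Finset.prod_ite_mem, Finset.univ_inter, Finset.prod_pair hij] at h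
  simp only [gram_apply, real_inner_self_eq_norm_sq]
  rw [h, sq]

/-- Here `A = n(n+2)` and `E[G_ii G_jj] = n²`, so `n² + 2C = A` forces `C = n`. -/
theorem integral_gram_mul (i j k l : ι) :
    ∫ x, gram ℝ x i j * gram ℝ x k l ∂gaussianFamily ι E =
      (Module.finrank ℝ E : ℝ) ^ 2 * ((1 : Matrix ι ι ℝ) i j * (1 : Matrix ι ι ℝ) k l) +
      Module.finrank ℝ E * ((1 : Matrix ι ι ℝ) i k * (1 : Matrix ι ι ℝ) j l +
        (1 : Matrix ι ι ℝ) i l * (1 : Matrix ι ι ℝ) j k) := by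
  have hsymm : ∀ (x : ι → E) i j, gram ℝ x i j = gram ℝ x j i := fun x i j => by
    simp only [gram_apply, real_inner_comm]
  have hA : ∀ i, ∫ x, gram ℝ x i i * gram ℝ x i i ∂gaussianFamily ι E =
      Module.finrank ℝ E * (Module.finrank ℝ E + 2) := by
    intro i
    simp only [gram_apply, real_inner_self_eq_norm_sq, ← sq (‖_‖ ^ 2)]
    rw [integral_comp_eval (μ := fun _ : ι => stdGaussian E) (f := fun y : E => (‖y‖ ^ 2) ^ 2)
      (Measurable.aestronglyMeasurable (by fun_prop))]
    exact integral_norm_pow_four_stdGaussian.2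
  have hint := fun i j k l => (integral_gram_mul_eq (E := E) (ι := ι) i j k l).1
  rw [integral_mul_of_isOrthogonallyInvariant measurable_gram isOrthogonallyInvariant_map_gram
    hsymm hint hA (C := Module.finrank ℝ E) (fun i j hij => ?_)]
  · ring
  · have h := integral_diag_mul_diag_of_isOrthogonallyInvariant measurable_gram
      isOrthogonallyInvariant_map_gram hsymm hint hA hij
    rw [integral_gram_diag_mul_diag hij] at h
    linarith

theorem measurable_gram_inv : Measurable fun x : ι → E => (gram ℝ x)⁻¹ :=
  measurable_matrix_inv.comp measurable_gram

theorem isOrthogonallyInvariant_map_gram_inv :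
    IsOrthogonallyInvariant ((gaussianFamily ι E).map fun x => (gram ℝ x)⁻¹) := by
  have h := (isOrthogonallyInvariant_map_gram (ι := ι) (E := E)).map_inv
  rwa [Measure.map_map measurable_matrix_inv measurable_gram] at h

theorem integral_gram_inv (h : Fintype.card ι + 1 < Module.finrank ℝ E) (i j : ι) :
    Integrable (fun x : ι → E => (gram ℝ x)⁻¹ i j) (gaussianFamily ι E) ∧
      ∫ x, (gram ℝ x)⁻¹ i j ∂gaussianFamily ι E =
        (Module.finrank ℝ E - Fintype.card ι - 1 : ℝ)⁻¹ * (1 : Matrix ι ι ℝ) i j := by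
  refine ⟨?_, integral_apply_eq_of_isOrthogonallyInvariant measurable_gram_inv
    isOrthogonallyInvariant_map_gram_inv (fun i => (integral_gram_inv_apply_self h i).2) i j⟩
  refine ((integral_gram_inv_apply_self h i).1.add (integral_gram_inv_apply_self h j).1).mono'
    (measurable_gram_inv_apply i j).aestronglyMeasurable ?_
  filter_upwards [ae_linearIndependent (ι := ι) (E := E) (by omega)] with x hx
  have h1 := (gram_inv_apply_self_pos hx i).le
  have h2 := (gram_inv_apply_self_pos hx j).le
  refine abs_le_of_sq_le_sq ?_ (add_nonneg h1 h2)
  have h3 := sq_gram_inv_le hx i j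
  simp only [Pi.add_apply]
  nlinarith [mul_nonneg h1 h2, sq_nonneg ((gram ℝ x)⁻¹ i i), sq_nonneg ((gram ℝ x)⁻¹ j j)]

theorem integrable_gram_inv_mul (h : Fintype.card ι + 3 < Module.finrank ℝ E) (i j k l : ι) :
    Integrable (fun x : ι → E => (gram ℝ x)⁻¹ i j * (gram ℝ x)⁻¹ k l) (gaussianFamily ι E) := by
  have hi := fun i => (integral_sq_gram_inv_apply_self (E := E) h i).1
  refine (((hi i).add (hi j)).add ((hi k).add (hi l))).mono'
    ((measurable_gram_inv_apply i j).mul (measurable_gram_inv_apply k l)).aestronglyMeasurable ?_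
  filter_upwards [ae_linearIndependent (ι := ι) (E := E) (by omega)] with x hx
  have h1 := sq_gram_inv_le hx i j
  have h2 := sq_gram_inv_le hx k l
  simp only [Pi.add_apply, Real.norm_eq_abs]
  refine abs_le.2 ⟨?_, ?_⟩ <;>
  nlinarith [sq_nonneg ((gram ℝ x)⁻¹ i i - (gram ℝ x)⁻¹ j j),
    sq_nonneg ((gram ℝ x)⁻¹ k k - (gram ℝ x)⁻¹ l l),
    sq_nonneg ((gram ℝ x)⁻¹ i j - (gram ℝ x)⁻¹ k l),
    sq_nonneg ((gram ℝ x)⁻¹ i j + (gram ℝ x)⁻¹ k l),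
    sq_nonneg ((gram ℝ x)⁻¹ i i), sq_nonneg ((gram ℝ x)⁻¹ j j),
    sq_nonneg ((gram ℝ x)⁻¹ k k), sq_nonneg ((gram ℝ x)⁻¹ l l)]

/-- With `m = n - p`, `E[T_ii T_jj] + 2C = A` and `E[T_ii T_jj] - C = 1/(m(m-1))`. Subtracting, `3C
= 1/((m-1)(m-3)) - 1/(m(m-1)) = 3/(m(m-1)(m-3))`. -/
theorem integral_gram_inv_mul (h : Fintype.card ι + 3 < Module.finrank ℝ E) (i j k l : ι) :
    ∫ x, (gram ℝ x)⁻¹ i j * (gram ℝ x)⁻¹ k l ∂gaussianFamily ι E =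
      ((Module.finrank ℝ E - Fintype.card ι : ℝ) * (Module.finrank ℝ E - Fintype.card ι - 1) *
        (Module.finrank ℝ E - Fintype.card ι - 3))⁻¹ *
      ((Module.finrank ℝ E - Fintype.card ι - 2) *
        ((1 : Matrix ι ι ℝ) i j * (1 : Matrix ι ι ℝ) k l) +
      ((1 : Matrix ι ι ℝ) i k * (1 : Matrix ι ι ℝ) j l +
        (1 : Matrix ι ι ℝ) i l * (1 : Matrix ι ι ℝ) j k)) := by
  set m : ℝ := Module.finrank ℝ E - Fintype.card ι with hm
  have hnp : (Fintype.card ι : ℝ) + 3 < Module.finrank ℝ E := by exact_mod_cast h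
  have hm0 : m ≠ 0 := by intro h; linarith
  have hm1 : m - 1 ≠ 0 := by intro h; linarith
  have hm3 : m - 3 ≠ 0 := by intro h; linarith
  have hsymm : ∀ (x : ι → E) i j, (gram ℝ x)⁻¹ i j = (gram ℝ x)⁻¹ j i := gram_inv_symm
  have hA : ∀ i, ∫ x, (gram ℝ x)⁻¹ i i * (gram ℝ x)⁻¹ i i ∂gaussianFamily ι E =
      ((m - 1) * (m - 3))⁻¹ := by
    intro i
    simp only [← sq]
    exact (integral_sq_gram_inv_apply_self h i).2
  have hint := integrable_gram_inv_mul (ι := ι) (E := E) h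
  rw [integral_mul_of_isOrthogonallyInvariant measurable_gram_inv
    isOrthogonallyInvariant_map_gram_inv hsymm hint hA (C := (m * (m - 1) * (m - 3))⁻¹)
    (fun i j hij => ?_)]
  · field_simp
  · have h1 := integral_diag_mul_diag_of_isOrthogonallyInvariant measurable_gram_inv
      isOrthogonallyInvariant_map_gram_inv hsymm hint hA hij
    have h2 := integral_gram_inv_minor (E := E) (by omega) hij
    simp only [sq] at h2
    rw [integral_sub (hint _ _ _ _) (hint _ _ _ _), ← hm] at h2
    have h3 : ((m - 1) * (m - 3))⁻¹ - (m * (m - 1))⁻¹ = 3 * (m * (m - 1) * (m - 3))⁻¹ := by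
      field_simp
      ring
    linarith

theorem ae_normalizedGram_inv [Nonempty ι] (h : Fintype.card ι ≤ Module.finrank ℝ E) :
    ∀ᵐ x ∂gaussianFamily ι E, IsUnit (normalizedGram x) ∧
      (normalizedGram x)⁻¹ = (gram ℝ x).trace • (gram ℝ x)⁻¹ := by
  filter_upwards [ae_linearIndependent (ι := ι) (E := E) h] with x hx
  have htr : (gram ℝ x).trace ≠ 0 := by
    intro h0
    obtain ⟨i⟩ := ‹Nonempty ι›
    have h1 := abs_gram_le_trace x i i
    rw [h0, gram_apply, real_inner_self_eq_norm_sq, abs_nonpos_iff] at h1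
    exact hx.ne_zero i (by simpa using h1)
  constructor
  · rw [Matrix.isUnit_iff_isUnit_det, normalizedGram, Matrix.det_smul]
    exact (isUnit_iff_ne_zero.2 (pow_ne_zero _ (inv_ne_zero htr))).mul (isUnit_det_gram hx)
  · rw [normalizedGram, inv_smul_matrix (inv_ne_zero htr), inv_inv]

theorem integral_normalizedGram_inv [Nonempty ι] (h : Fintype.card ι + 1 < Module.finrank ℝ E)
    (i j : ι) :
    Integrable (fun x : ι → E => (normalizedGram x)⁻¹ i j) (gaussianFamily ι E) ∧
      ∫ x, (normalizedGram x)⁻¹ i j ∂gaussianFamily ι E =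
        (Module.finrank ℝ E * Fintype.card ι - 2) *
          ∫ x, (gram ℝ x)⁻¹ i j ∂gaussianFamily ι E := by
  obtain ⟨h1, h2⟩ := integral_trace_gram_mul_of_homogeneous (E := E) (d := -2)
    (fun c x hc => by
      rw [gram_smul, inv_smul_matrix (by positivity), Matrix.smul_apply, smul_eq_mul]
      norm_cast) (integral_gram_inv h i j).1
  have h3 : (fun x : ι → E => (gram ℝ x).trace * (gram ℝ x)⁻¹ i j) =ᵐ[gaussianFamily ι E]
      fun x => (normalizedGram x)⁻¹ i j := by
    filter_upwards [ae_normalizedGram_inv (ι := ι) (E := E) (by omega)] with x hx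
    rw [hx.2, Matrix.smul_apply, smul_eq_mul]
  refine ⟨h1.congr h3, ?_⟩
  rw [← integral_congr_ae h3, h2]
  push_cast
  ring

/-- Each factor of the trace raises the degree by 2: from -4 to -2, giving `np - 4`, then from -2 to
0, giving `np - 2`. -/
theorem integral_normalizedGram_inv_mul [Nonempty ι]
    (h : Fintype.card ι + 3 < Module.finrank ℝ E) (i j k l : ι) :
    Integrable (fun x : ι → E => (normalizedGram x)⁻¹ i j * (normalizedGram x)⁻¹ k l)
        (gaussianFamily ι E) ∧
      ∫ x, (normalizedGram x)⁻¹ i j * (normalizedGram x)⁻¹ k l ∂gaussianFamily ι E =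
        (Module.finrank ℝ E * Fintype.card ι - 2) * (Module.finrank ℝ E * Fintype.card ι - 4) *
          ∫ x, (gram ℝ x)⁻¹ i j * (gram ℝ x)⁻¹ k l ∂gaussianFamily ι E := by
  obtain ⟨h1, h2⟩ := integral_trace_gram_mul_of_homogeneous (E := E) (d := -4)
    (fun c x hc => by
      rw [gram_smul, inv_smul_matrix (by positivity), Matrix.smul_apply, Matrix.smul_apply,
        smul_eq_mul, smul_eq_mul, mul_mul_mul_comm, ← mul_inv, ← pow_add]
      norm_cast) (integrable_gram_inv_mul h i j k l)
  obtain ⟨h3, h4⟩ := integral_trace_gram_mul_of_homogeneous (E := E) (d := -2)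
    (fun c x hc => by
      rw [gram_smul, inv_smul_matrix (by positivity), Matrix.smul_apply, Matrix.smul_apply,
        Matrix.trace_smul, smul_eq_mul, smul_eq_mul, smul_eq_mul]
      rw [_root_.zpow_neg, zpow_ofNat]
      field_simp) h1
  have h5 : (fun x : ι → E => (gram ℝ x).trace * ((gram ℝ x).trace *
      ((gram ℝ x)⁻¹ i j * (gram ℝ x)⁻¹ k l))) =ᵐ[gaussianFamily ι E]
      fun x => (normalizedGram x)⁻¹ i j * (normalizedGram x)⁻¹ k l := by
    filter_upwards [ae_normalizedGram_inv (ι := ι) (E := E) (by omega)] with x hx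
    rw [hx.2, Matrix.smul_apply, Matrix.smul_apply, smul_eq_mul, smul_eq_mul]
    ring
  refine ⟨h3.congr h5, ?_⟩
  rw [← integral_congr_ae h5, h4, h2]
  push_cast
  ring

end Moments

theorem normalizedWishart_eq (n p : ℕ) : normalizedWishart n p =
    (gaussianFamily (Fin p) (EuclideanSpace ℝ (Fin n))).map normalizedGram := by
  rw [normalizedWishart, wishart_one_eq, Measure.map_map (measurable_trace_inv_smul p)
    measurable_gram]
  rfl

theorem hasExpectation_of_hasLaw {Ω Ω' ι κ α : Type*} [MeasurableSpace Ω] [MeasurableSpace Ω']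
    [MeasurableSpace α] {P : Measure Ω} {μ : Measure Ω'} {V : Ω → α} {T : Ω' → α}
    (hT : Measurable T) (hV : HasLaw V (μ.map T) P) {H : α → Matrix ι κ ℝ}
    (hH : Measurable H) {M : Matrix ι κ ℝ} (h : HasExpectation (fun ω => H (T ω)) M μ) :
    HasExpectation (fun ω => H (V ω)) M P := by
  intro i j
  have hm : Measurable fun v => H v i j :=
    (measurable_pi_apply j).comp ((measurable_pi_apply i).comp hH)
  obtain ⟨h1, h2⟩ := h i j
  constructor
  · have h3 := (integrable_map_measure hm.aestronglyMeasurable hT.aemeasurable).2 h1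
    rw [← hV.map_eq] at h3
    exact (integrable_map_measure hm.aestronglyMeasurable hV.aemeasurable).1 h3
  · rw [← h2, ← integral_map hV.aemeasurable hm.aestronglyMeasurable, hV.map_eq,
      integral_map hT.aemeasurable hm.aestronglyMeasurable]

theorem measurable_vecMulVec_vec (p : ℕ) :
    Measurable fun S : Matrix (Fin p) (Fin p) ℝ => vecMulVec (vec S) (vec S) := by
  refine measurable_pi_iff.2 fun a => measurable_pi_iff.2 fun b => ?_
  exact (measurable_matrix_apply _ _).mul (measurable_matrix_apply _ _)

theorem one_apply_prod {p : ℕ} (a b : Fin p × Fin p) :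
    (1 : Matrix (Fin p × Fin p) (Fin p × Fin p) ℝ) a b =
      (1 : Matrix (Fin p) (Fin p) ℝ) a.2 b.2 * (1 : Matrix (Fin p) (Fin p) ℝ) a.1 b.1 := by
  simp only [Matrix.one_apply, Prod.ext_iff]
  split_ifs <;> simp_all

/-- With `i, j, k, l = a.2, a.1, b.2, b.1` this is the pairing `δ_il δ_jk`, while the identity
matrix is `δ_ik δ_jl`. -/
theorem commutationMatrix_apply_prod {p : ℕ} (a b : Fin p × Fin p) :
    commutationMatrix p a b =
      (1 : Matrix (Fin p) (Fin p) ℝ) a.2 b.1 * (1 : Matrix (Fin p) (Fin p) ℝ) a.1 b.2 := by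
  simp only [commutationMatrix, Matrix.of_apply, Matrix.one_apply, Prod.ext_iff, Prod.fst_swap,
    Prod.snd_swap, eq_comm (a := b.1), eq_comm (a := b.2)]
  split_ifs <;> simp_all

end

theorem mainTheorem9 {Ω : Type*} [MeasurableSpace Ω] (P : Measure Ω) [IsProbabilityMeasure P]
    (n p : ℕ) (hp : 1 ≤ p) (hpn : p ≤ n) (V : Ω → Matrix (Fin p) (Fin p) ℝ)
    (hV : HasLaw V (normalizedWishart n p) P) :
    HasExpectation V ((1 / (p : ℝ)) • (1 : Matrix (Fin p) (Fin p) ℝ)) P ∧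
    HasExpectation (fun ω => vecMulVec (vec (V ω)) (vec (V ω)))
      ((1 / ((n : ℝ) * p * (n * p + 2))) •
        ((n : ℝ) • (1 + commutationMatrix p) +
          (n : ℝ) ^ 2 • vecMulVec (vec (1 : Matrix (Fin p) (Fin p) ℝ))
            (vec (1 : Matrix (Fin p) (Fin p) ℝ)))) P ∧
    (∀ᵐ ω ∂P, IsUnit (V ω)) ∧
    (p + 1 < n →
      HasExpectation (fun ω => (V ω)⁻¹)
        ((((n : ℝ) * p - 2) / ((n : ℝ) - p - 1)) • (1 : Matrix (Fin p) (Fin p) ℝ)) P) ∧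
    (p + 3 < n →
      HasExpectation (fun ω => vecMulVec (vec ((V ω)⁻¹)) (vec ((V ω)⁻¹)))
        (((((n : ℝ) * p - 2) * ((n : ℝ) * p - 4)) /
            (((n : ℝ) - p) * ((n : ℝ) - p - 1) * ((n : ℝ) - p - 3))) •
          ((1 + commutationMatrix p) +
            ((n : ℝ) - p - 2) • vecMulVec (vec (1 : Matrix (Fin p) (Fin p) ℝ))
              (vec (1 : Matrix (Fin p) (Fin p) ℝ)))) P) := by
  rw [normalizedWishart_eq] at hV
  have hne : Nonempty (Fin p) := ⟨⟨0, hp⟩⟩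
  have hmeas := measurable_normalizedGram (ι := Fin p) (E := EuclideanSpace ℝ (Fin n))
  have hfin : Module.finrank ℝ (EuclideanSpace ℝ (Fin n)) = n := by simp
  have hp0 : (0 : ℝ) < p := by exact_mod_cast hp
  have hn0 : (0 : ℝ) < n := by exact_mod_cast hp.trans hpn
  refine ⟨?_, ?_, ?_, fun h => ?_, fun h => ?_⟩
  · refine hasExpectation_of_hasLaw hmeas hV (H := fun S => S) measurable_id fun i j =>
      ⟨integrable_normalizedGram i j, ?_⟩
    have h := integral_gram_eq (E := EuclideanSpace ℝ (Fin n)) i j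
    rw [integral_gram, hfin, Fintype.card_fin] at h
    rw [Matrix.smul_apply, smul_eq_mul, one_div, eq_inv_mul_iff_mul_eq₀ hp0.ne']
    refine mul_left_cancel₀ hn0.ne' ?_
    rw [h]
    ring
  · refine hasExpectation_of_hasLaw hmeas hV (measurable_vecMulVec_vec p) fun a b =>
      ⟨integrable_normalizedGram_mul _ _ _ _, ?_⟩
    -- `vec` indexes entries by (column, row), hence the swapped components.
    have h := (integral_gram_mul_eq (E := EuclideanSpace ℝ (Fin n)) a.2 a.1 b.2 b.1).2
    rw [integral_gram_mul, hfin, Fintype.card_fin] at h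
    simp only [vecMulVec_apply, vec, Matrix.smul_apply, Matrix.add_apply, smul_eq_mul,
      one_apply_prod, commutationMatrix_apply_prod]
    rw [one_div, eq_inv_mul_iff_mul_eq₀ (by positivity)]
    linear_combination -h
  · have hs : MeasurableSet {S : Matrix (Fin p) (Fin p) ℝ | IsUnit S} := by
      simp only [Matrix.isUnit_iff_isUnit_det, isUnit_iff_ne_zero]
      exact (measurableSet_eq_fun (Continuous.measurable (by fun_prop)) measurable_const).compl
    refine ae_of_ae_map hV.aemeasurable ?_
    rw [hV.map_eq, ae_map_iff hmeas.aemeasurable hs]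
    filter_upwards [ae_normalizedGram_inv (ι := Fin p) (E := EuclideanSpace ℝ (Fin n))
      (by simpa using hpn)] with x hx using hx.1
  · have h' : Fintype.card (Fin p) + 1 < Module.finrank ℝ (EuclideanSpace ℝ (Fin n)) := by
      simpa using h
    refine hasExpectation_of_hasLaw hmeas hV measurable_matrix_inv fun i j =>
      ⟨(integral_normalizedGram_inv h' i j).1, ?_⟩
    rw [(integral_normalizedGram_inv h' i j).2, (integral_gram_inv h' i j).2, hfin,
      Fintype.card_fin, Matrix.smul_apply, smul_eq_mul, div_eq_mul_inv, mul_assoc]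
  · have h' : Fintype.card (Fin p) + 3 < Module.finrank ℝ (EuclideanSpace ℝ (Fin n)) := by
      simpa using h
    refine hasExpectation_of_hasLaw hmeas hV
      ((measurable_vecMulVec_vec p).comp measurable_matrix_inv) fun a b =>
      ⟨(integral_normalizedGram_inv_mul h' a.2 a.1 b.2 b.1).1, ?_⟩
    refine (integral_normalizedGram_inv_mul h' a.2 a.1 b.2 b.1).2.trans ?_
    rw [integral_gram_inv_mul h', hfin, Fintype.card_fin]
    simp only [vecMulVec_apply, vec, Matrix.smul_apply, Matrix.add_apply, smul_eq_mul,
      one_apply_prod, commutationMatrix_apply_prod]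
    rw [div_eq_mul_inv]
    ring
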